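/- Let $M$ be a locally compact separable metric space and let $G=\mathrm{Iso}(M)$ be its isometry group, endowed with the topology of pointwise convergence. Let $(X,\lambda)$ be a standard $\sigma$-finite space, that is, an uncountable standard Borel space $X$ with a non-zero atomless $\sigma$-finite Borel measure $\lambda$. Let $\alpha : G\times X\to X$ be a boolean measure-preserving $G$-action on $(X,\lambda)$, that is, a Borel map such that for every $g\in G$ the map $\alpha(g,\cdot)$ is a measure-preserving bijection of $(X,\lambda)$, and such that for all $g,h\in G$ one has $\alpha(gh,x)=\alpha(g,\alpha(h,x))$ for $\lambda$-almost every $x\in X$. Then: (1) $\alpha$ admits a continuous Radon model: there are a locally compact Polish space $Y$ with a Radon measure $\eta$, a (jointly) continuous measure-preserving action $\beta : G\times Y\to Y$, a conull Borel set $X_0\subseteq X$ and a measure-preserving Borel injection $\Phi : X_0\to Y$ such that for every $g\in G$, for $\lambda$-almost every $x\in X_0$, one has $\alpha(g,x)\in X_0$ and $\Phi(\alpha(g,x))=\beta(g,\Phi(x))$. (2) Moreover the model can be taken on $X$ itself: there are a locally compact Polish topology on $X$ which induces its standard Borel structure and for which $\lambda$ is a Radon measure, and a (jointly) continuous measure-preserving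 action $\beta : G\times X\to X$ such that for every $g\in G$ one has $\beta(g,x)=\alpha(g,x)$ for $\lambda$-almost every $x\in X$. -/

import Mathlib

open MeasureTheory Topology

universe u

/-- The isometry group of a metric space carries the topology of pointwise convergence. -/
instance isometryGroupTopology (M : Type*) [MetricSpace M] : TopologicalSpace (M ≃ᵢ M) :=
  TopologicalSpace.induced (fun g : M ≃ᵢ M => (g : M → M)) Pi.topologicalSpace

/-- The isometry group carries the Borel σ-algebra of the topology of pointwise convergence. -/
instance isometryGroupMeasurableSpace (M : Type*) [MetricSpace M] : MeasurableSpace (M ≃ᵢ M) :=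
  borel (M ≃ᵢ M)

/-- A boolean measure-preserving action of `G` on `(X, lam)`: a Borel map `α : G × X → X` such that
every `α (g, ·)` is a measure-preserving bijection and, for each pair `g, h`, the action identity
holds at almost every point (the null set may depend on `g` and `h`). -/
structure IsBooleanAction {G X : Type*} [Group G] [MeasurableSpace G] [MeasurableSpace X]
    (α : G × X → X) (lam : Measure X) : Prop where
  measurable : Measurable α
  mul_ae : ∀ g h : G, ∀ᵐ x ∂lam, α (g * h, x) = α (g, α (h, x))
  bijective : ∀ g : G, Function.Bijective fun x => α (g, x)
  measurePreserving : ∀ g : G, MeasurePreserving (fun x => α (g, x)) lam lam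

/-- A continuous measure-preserving action of `G` on a topological measured space `(Y, eta)`: a
genuine action, everywhere defined, which is jointly continuous and preserves the measure. -/
structure IsContinuousAction {G Y : Type*} [Group G] [TopologicalSpace G] [TopologicalSpace Y]
    [MeasurableSpace Y] (β : G × Y → Y) (eta : Measure Y) : Prop where
  one_act : ∀ y : Y, β (1, y) = y
  mul_act : ∀ (g h : G) (y : Y), β (g * h, y) = β (g, β (h, y))
  continuous : Continuous β
  measurePreserving : ∀ g : G, MeasurePreserving (fun y => β (g, y)) eta eta

/-- `Φ : X₀ → Y` is a boolean isomorphism from the action `α` on `(X, lam)` to the action `β` on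
`(Y, eta)`: `X₀` is a conull Borel subset of `X`, `Φ` is a measure-preserving Borel injection, and
for each `g` the relation `Φ (α (g, x)) = β (g, Φ x)` holds (both sides being defined) for almost
every `x`. -/
structure IsBooleanIso {G X Y : Type*} [MeasurableSpace X] [MeasurableSpace Y]
    (α : G × X → X) (lam : Measure X) (β : G × Y → Y) (eta : Measure Y)
    (X₀ : Set X) (Φ : X₀ → Y) : Prop where
  measurableSet : MeasurableSet X₀
  conull : ∀ᵐ x ∂lam, x ∈ X₀
  injective : Function.Injective Φ
  measurePreserving : MeasurePreserving Φ (lam.comap Subtype.val) eta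
  equivariant : ∀ g : G, ∀ᵐ x ∂lam, ∃ (hx : x ∈ X₀) (hgx : α (g, x) ∈ X₀),
    Φ ⟨α (g, x), hgx⟩ = β (g, Φ ⟨x, hx⟩)

/-- The action `α` on `(X, lam)` admits a continuous Radon model: it is booleanly isomorphic to a
continuous measure-preserving action on a locally compact Polish space endowed with a Radon
measure. (`Measure.Regular`: finite on compact sets, outer regular on Borel sets, inner regular
for compact sets on open sets.) -/
def AdmitsContinuousRadonModel {G : Type*} {X : Type u} [Group G] [TopologicalSpace G]
    [MeasurableSpace X] (α : G × X → X) (lam : Measure X) : Prop :=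
  ∃ (Y : Type u) (_ : TopologicalSpace Y) (_ : MeasurableSpace Y) (eta : Measure Y)
    (β : G × Y → Y) (X₀ : Set X) (Φ : X₀ → Y),
    LocallyCompactSpace Y ∧ PolishSpace Y ∧ BorelSpace Y ∧ eta.Regular ∧
      IsContinuousAction β eta ∧ IsBooleanIso α lam β eta X₀ Φ

/-- The action `α` on `(X, lam)` lifts to a continuous Radon action on `X` itself: there are a
locally compact Polish topology on `X` whose Borel σ-algebra is the given one and for which `lam`
is Radon, and a continuous measure-preserving action `β` on `X` such that each `β (g, ·)` coincides
almost everywhere with `α (g, ·)`. -/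
def LiftsToContinuousRadonAction {G X : Type*} [Group G] [TopologicalSpace G]
    [MeasurableSpace X] (α : G × X → X) (lam : Measure X) : Prop :=
  ∃ (_ : TopologicalSpace X) (β : G × X → X),
    LocallyCompactSpace X ∧ PolishSpace X ∧ BorelSpace X ∧ lam.Regular ∧
      IsContinuousAction β lam ∧ ∀ g : G, ∀ᵐ x ∂lam, β (g, x) = α (g, x)

open Filter Set

/-! ### The isometry group as a second countable Baire group -/

section IsometryGroup

variable {M : Type*} [MetricSpace M]

/-! The point is to find enough functions on `X` that vary continuously along orbits in a uniform
sense. The group is Polish, so by Pettis' theorem the Koopman representation on L² is continuous: a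
bounded `f` is almost fixed by every isometry that moves a finite tuple `w₀` of points of `M` by
little. The closure `Z` of the orbit of `w₀` is locally compact, and the group acts on it
isometrically with a dense orbit. It carries an invariant Radon measure, built as Haar measure is,
with covering numbers as the content (`exists_isometry_invariant_measure`).

Over each `z` in `Z`, take the vector of least norm in the closed convex hull of the translates of
`f` indexed near `z`. This is a measurable equivariant field of vectors
(`exists_equivariant_selection`), close to `f` near the base point. Averaging it against a Lipschitz
bump moves all dependence on `h` into the bump: the average `f'` is close to `f`, and `f' ∘ α (h, ·)
- f'` is bounded almost everywhere by a multiple of the displacement of the base point by `h`, a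
continuous length function (`exists_lipschitz_approximation`).

Countably many such functions separate points almost everywhere. Sending `x` to the family `g ↦ f i
(α (g, x))` maps `X` into a compact metrizable space of Lipschitz families, where right translation
is a genuine jointly continuous action. A McShane extension from a dense sequence repairs the null
sets. Removing the zero family makes the image measure locally finite, the approximants being in L²
(`liftsToContinuousRadonAction_of_lipschitz_family`). A Borel isomorphism equal to this map almost
everywhere pulls the model back to `X`, giving (2), and (1) follows. -/

theorem tendsto_isometryEquiv_iff {ι : Type*} {l : Filter ι} {F : ι → M ≃ᵢ M} {g : M ≃ᵢ M} :
    Tendsto F l (𝓝 g) ↔ ∀ x, Tendsto (fun i => F i x) l (𝓝 (g x)) := by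
  rw [(Topology.IsInducing.induced (fun g : M ≃ᵢ M => (g : M → M))).tendsto_nhds_iff,
    tendsto_pi_nhds]
  rfl

theorem continuous_isometryEquiv_apply (x : M) : Continuous fun g : M ≃ᵢ M => g x :=
  continuous_iff_continuousAt.2 fun _ => tendsto_isometryEquiv_iff.1 tendsto_id x

instance isometryEquiv_isTopologicalGroup : IsTopologicalGroup (M ≃ᵢ M) where
  continuous_mul := by
    refine continuous_iff_continuousAt.2 fun p => tendsto_isometryEquiv_iff.2 fun x => ?_
    have h1 : Tendsto (fun q : (M ≃ᵢ M) × (M ≃ᵢ M) => q.1 (p.2 x)) (𝓝 p) (𝓝 (p.1 (p.2 x))) :=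
      ((continuous_isometryEquiv_apply (p.2 x)).comp continuous_fst).continuousAt
    have h2 : Tendsto (fun q : (M ≃ᵢ M) × (M ≃ᵢ M) => dist (q.2 x) (p.2 x)) (𝓝 p) (𝓝 0) := by
      rw [← tendsto_iff_dist_tendsto_zero]
      exact ((continuous_isometryEquiv_apply x).comp continuous_snd).continuousAt
    refine tendsto_of_tendsto_of_dist h1 ?_
    refine h2.congr fun q => ?_
    rw [dist_comm, IsometryEquiv.mul_apply, q.1.dist_eq]
  continuous_inv := by
    refine continuous_iff_continuousAt.2 fun g => tendsto_isometryEquiv_iff.2 fun x => ?_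
    rw [tendsto_iff_dist_tendsto_zero]
    have h2 : Tendsto (fun q : (M ≃ᵢ M) => dist (q (g⁻¹ x)) (g (g⁻¹ x))) (𝓝 g) (𝓝 0) := by
      rw [← tendsto_iff_dist_tendsto_zero]
      exact (continuous_isometryEquiv_apply (g⁻¹ x)).continuousAt
    refine h2.congr fun q => ?_
    rw [IsometryEquiv.apply_inv_self, ← q.dist_eq (q⁻¹ x), IsometryEquiv.apply_inv_self, dist_comm]

instance isometryEquiv_borelSpace : BorelSpace (M ≃ᵢ M) := ⟨rfl⟩

/-- Every neighbourhood of the identity contains the isometries that move finitely many given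
points by a small amount. -/
theorem exists_finset_isometryEquiv_mem {V : Set (M ≃ᵢ M)} (hV : V ∈ 𝓝 1) :
    ∃ (s : Finset M) (δ : ℝ), 0 < δ ∧ ∀ g : M ≃ᵢ M, (∀ x ∈ s, dist (g x) x < δ) → g ∈ V := by
  rw [nhds_induced, Filter.mem_comap] at hV
  obtain ⟨t, ht, htV⟩ := hV
  rw [nhds_pi, Filter.mem_pi] at ht
  obtain ⟨I, hI, U, hU, hUt⟩ := ht
  have : ∀ x, ∃ δ > 0, Metric.ball x δ ⊆ U x := fun x => Metric.mem_nhds_iff.1 (hU x)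
  choose δ hδ hball using this
  rcases hI.toFinset.eq_empty_or_nonempty with he | hne
  · refine ⟨∅, 1, one_pos, fun g _ => htV (hUt fun x hx => ?_)⟩
    have : x ∈ hI.toFinset := hI.mem_toFinset.2 hx
    simp [he] at this
  · refine ⟨hI.toFinset, hI.toFinset.inf' hne δ, ?_, fun g hg => htV (hUt fun x hx => ?_)⟩
    · rw [Finset.lt_inf'_iff]
      exact fun x _ => hδ x
    · have hx' : x ∈ hI.toFinset := hI.mem_toFinset.2 hx
      exact hball x (Metric.mem_ball.2 ((hg x hx').trans_le (Finset.inf'_le _ hx')))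

/-- The map sending an isometry `g` to the pair of continuous maps `(g, g⁻¹)`. -/
def isometryEquivToContinuousMaps (g : M ≃ᵢ M) : C(M, M) × C(M, M) :=
  (⟨g, g.continuous⟩, ⟨g.symm, g.symm.continuous⟩)

/-- Isometries are equicontinuous, so convergence at the centre of a small ball controls the whole
ball. -/
theorem continuous_isometryEquiv_toContinuousMap [LocallyCompactSpace M] :
    Continuous fun g : M ≃ᵢ M => (⟨g, g.continuous⟩ : C(M, M)) := by
  refine continuous_iff_continuousAt.2 fun g => ?_
  refine ContinuousMap.tendsto_iff_tendstoLocallyUniformly.2 ?_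
  refine Metric.tendstoLocallyUniformly_iff.2 fun ε hε x => ?_
  refine ⟨Metric.ball x (ε / 3), Metric.ball_mem_nhds x (by positivity), ?_⟩
  have := Metric.tendsto_nhds.1 ((continuous_isometryEquiv_apply x).continuousAt (x := g)) (ε / 3)
    (by positivity)
  filter_upwards [this] with q hq y hy
  have h1 : dist (g y) (g x) < ε / 3 := by rw [g.dist_eq]; exact hy
  have h2 : dist (q x) (q y) < ε / 3 := by rw [q.dist_eq, dist_comm]; exact hy
  have h3 : dist (g x) (q x) < ε / 3 := by rw [dist_comm]; exact hq
  calc dist (g y) (q y) ≤ dist (g y) (g x) + dist (g x) (q x) + dist (q x) (q y) :=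
        dist_triangle4 _ _ _ _
    _ < ε := by linarith

/-- A limit of surjective isometries may fail to be surjective. Recording the inverse as well makes
the range closed, since being mutually inverse is a closed condition. -/
theorem isClosedEmbedding_isometryEquivToContinuousMaps [LocallyCompactSpace M] :
    IsClosedEmbedding (isometryEquivToContinuousMaps : M ≃ᵢ M → C(M, M) × C(M, M)) := by
  have hcont : Continuous (isometryEquivToContinuousMaps : M ≃ᵢ M → C(M, M) × C(M, M)) :=
    continuous_isometryEquiv_toContinuousMap.prodMk
      (continuous_isometryEquiv_toContinuousMap.comp continuous_inv)
  have hind : IsInducing (isometryEquivToContinuousMaps : M ≃ᵢ M → C(M, M) × C(M, M)) := by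
    refine IsInducing.of_comp (g := fun p : C(M, M) × C(M, M) => (p.1 : M → M)) hcont ?_ ⟨rfl⟩
    exact continuous_pi fun x => (continuous_eval_const x).comp continuous_fst
  refine ⟨⟨hind, fun g h hgh => ?_⟩, ?_⟩
  · ext x
    exact DFunLike.congr_fun (congrArg Prod.fst hgh) x
  · have : range (isometryEquivToContinuousMaps : M ≃ᵢ M → C(M, M) × C(M, M)) =
        {p | p.1.comp p.2 = ContinuousMap.id M} ∩ {p | p.2.comp p.1 = ContinuousMap.id M} ∩
          ⋂ (x : M) (y : M), {p | dist (p.1 x) (p.1 y) = dist x y} := by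
      ext p
      simp only [mem_range, mem_inter_iff, mem_ofPred_eq, mem_iInter]
      constructor
      · rintro ⟨g, rfl⟩
        exact ⟨⟨by ext x; simp [isometryEquivToContinuousMaps],
          by ext x; simp [isometryEquivToContinuousMaps]⟩, fun x y => g.dist_eq x y⟩
      · rintro ⟨⟨h1, h2⟩, h3⟩
        refine ⟨⟨⟨p.1, p.2, fun x => DFunLike.congr_fun h2 x, fun x => DFunLike.congr_fun h1 x⟩,
          Isometry.of_dist_eq h3⟩, ?_⟩
        rfl
    rw [this]
    refine (IsClosed.inter ?_ ?_).inter (isClosed_iInter fun x => isClosed_iInter fun y => ?_)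
    · exact isClosed_eq (continuous_fst.compCM continuous_snd) continuous_const
    · exact isClosed_eq (continuous_snd.compCM continuous_fst) continuous_const
    · refine isClosed_eq (Continuous.dist ?_ ?_) continuous_const
      · exact (continuous_eval_const x).comp continuous_fst
      · exact (continuous_eval_const y).comp continuous_fst

theorem isCompletelyMetrizableSpace_continuousMap (X Y : Type*) [TopologicalSpace X]
    [TopologicalSpace Y] [LocallyCompactSpace X] [SigmaCompactSpace X]
    [TopologicalSpace.IsCompletelyMetrizableSpace Y] :
    TopologicalSpace.IsCompletelyMetrizableSpace C(X, Y) := by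
  let := TopologicalSpace.upgradeIsCompletelyMetrizable Y
  infer_instance

variable (M) in
-- The given metric need not be complete, but `M` is open in its completion: a compact neighbourhood
-- is closed there, and by density its closure is a neighbourhood.
theorem isCompletelyMetrizableSpace_of_locallyCompact [LocallyCompactSpace M]
    [TopologicalSpace.SeparableSpace M] : TopologicalSpace.IsCompletelyMetrizableSpace M := by
  have := UniformSpace.secondCountable_of_separable M
  have hopen : IsOpen (range ((↑) : M → UniformSpace.Completion M)) := by
    rw [isOpen_iff_mem_nhds]
    rintro _ ⟨x, rfl⟩
    obtain ⟨K, hK, hKx⟩ := exists_compact_mem_nhds x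
    have hcl : IsClosed (((↑) : M → UniformSpace.Completion M) '' K) :=
      (hK.image (UniformSpace.Completion.continuous_coe M)).isClosed
    refine mem_of_superset ?_ (hcl.closure_eq.subset.trans (image_subset_range _ _))
    exact (UniformSpace.Completion.isDenseInducing_coe).closure_image_mem_nhds hKx
  have := hopen.polishSpace
  have : PolishSpace M :=
    (UniformSpace.Completion.isUniformEmbedding_coe
      M).isEmbedding.toHomeomorph.isClosedEmbedding.polishSpace
  infer_instance

instance isometryEquiv_secondCountable [LocallyCompactSpace M]
    [TopologicalSpace.SeparableSpace M] : SecondCountableTopology (M ≃ᵢ M) := by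
  have := UniformSpace.secondCountable_of_separable M
  exact isClosedEmbedding_isometryEquivToContinuousMaps.isEmbedding.secondCountableTopology

instance isometryEquiv_baireSpace [LocallyCompactSpace M]
    [TopologicalSpace.SeparableSpace M] : BaireSpace (M ≃ᵢ M) := by
  have := UniformSpace.secondCountable_of_separable M
  have := isCompletelyMetrizableSpace_of_locallyCompact M
  have := isCompletelyMetrizableSpace_continuousMap M M
  have := isClosedEmbedding_isometryEquivToContinuousMaps (M := M).IsCompletelyMetrizableSpace
  let := TopologicalSpace.upgradeIsCompletelyMetrizable (M ≃ᵢ M)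
  infer_instance

end IsometryGroup

/-! ### Automatic continuity of the Koopman representation -/

section Koopman

/-- Pettis' theorem. -/
theorem eventually_exists_mul_mem_of_not_isMeagre {G : Type*} [Group G] [TopologicalSpace G]
    [IsTopologicalGroup G] [BaireSpace G] [MeasurableSpace G] [BorelSpace G] {E : Set G}
    (hE : MeasurableSet E) (hn : ¬ IsMeagre E) :
    ∀ᶠ g in 𝓝 (1 : G), ∃ a ∈ E, g * a ∈ E := by
  obtain ⟨O, hO, hEO⟩ := hE.residualEq_isOpen
  have hne : O.Nonempty := by
    rw [nonempty_iff_ne_empty]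
    rintro rfl
    refine hn ?_
    have : Eᶜ ∈ residual G := by
      filter_upwards [hEO] with x hx
      intro hxE
      exact (hx.mp hxE).elim
    exact this
  obtain ⟨o, ho⟩ := hne
  have hW : ∀ᶠ g in 𝓝 (1 : G), g * o ∈ O := by
    refine (continuous_mul_const o).continuousAt.eventually (hO.mem_nhds ?_)
    simpa using ho
  filter_upwards [hW] with w hw
  -- On a comeagre set, `E` and `O` agree both at `x` and at `w * x`; such an `x` exists in the
  -- nonempty open set `O ∩ w⁻¹O`.
  have h2 : ∀ᶠ x in residual G, (w * x ∈ E) = (w * x ∈ O) :=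
    (tendsto_residual_of_isOpenMap (continuous_const_mul w) (isOpenMap_mul_left w)).eventually hEO
  have hd : Dense {x | (x ∈ E) = (x ∈ O) ∧ (w * x ∈ E) = (w * x ∈ O)} :=
    dense_of_mem_residual (hEO.and h2)
  obtain ⟨x, ⟨hx1, hx2⟩, hx3, hx4⟩ := hd.inter_open_nonempty (O ∩ (fun x => w * x) ⁻¹' O)
    (hO.inter (hO.preimage (continuous_const_mul w))) ⟨o, ho, hw⟩
  exact ⟨x, hx3.mpr hx1, hx4.mpr hx2⟩

variable {G X : Type*} [Group G] [MeasurableSpace G] [MeasurableSpace X]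
  {α : G × X → X} {lam : Measure X}

/-- The identity law is not assumed: it follows from the law for `1 * 1` by cancelling the injective
map `α (1, ·)`. -/
theorem IsBooleanAction.one_ae (hα : IsBooleanAction α lam) : ∀ᵐ x ∂lam, α (1, x) = x := by
  filter_upwards [hα.mul_ae 1 1] with x hx
  rw [one_mul] at hx
  exact ((hα.bijective 1).injective hx).symm

/-- The Koopman operator `f ↦ f ∘ α (g, ·)` on `L²`. -/
noncomputable def koopman (hα : IsBooleanAction α lam) (g : G) :
    Lp ℝ 2 lam →ₗᵢ[ℝ] Lp ℝ 2 lam :=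
  Lp.compMeasurePreservingₗᵢ ℝ (fun x => α (g, x)) (hα.measurePreserving g)

theorem coeFn_koopman (hα : IsBooleanAction α lam) (g : G) (f : Lp ℝ 2 lam) :
    koopman hα g f =ᵐ[lam] fun x => f (α (g, x)) :=
  Lp.coeFn_compMeasurePreserving f (hα.measurePreserving g)

/-- The order of the factors is reversed, which is the source of the inverses in the equivariance
statements below. -/
theorem koopman_mul (hα : IsBooleanAction α lam) (g h : G) (f : Lp ℝ 2 lam) :
    koopman hα (g * h) f = koopman hα h (koopman hα g f) := by
  refine Lp.ext ?_
  have h1 := (hα.measurePreserving h).quasiMeasurePreserving.ae (coeFn_koopman hα g f)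
  filter_upwards [coeFn_koopman hα (g * h) f, coeFn_koopman hα h (koopman hα g f), h1,
    hα.mul_ae g h] with x hx1 hx2 hx3 hx4
  rw [hx1, hx2, hx3, hx4]

theorem koopman_one (hα : IsBooleanAction α lam) (f : Lp ℝ 2 lam) : koopman hα 1 f = f := by
  refine Lp.ext ?_
  filter_upwards [coeFn_koopman hα 1 f, hα.one_ae] with x hx1 hx2
  rw [hx1, hx2]

theorem measurableSet_norm_koopman_sub_lt [SFinite lam] (hα : IsBooleanAction α lam)
    (f v : Lp ℝ 2 lam) (r : ℝ) : MeasurableSet {g | ‖koopman hα g f - v‖ < r} := by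
  have hm : Measurable fun g => eLpNorm (fun x => f (α (g, x)) - v x) 2 lam := by
    simp_rw [eLpNorm_eq_lintegral_rpow_enorm_toReal two_ne_zero ENNReal.ofNat_ne_top]
    refine Measurable.pow_const ?_ _
    refine Measurable.lintegral_prod_right' (f := fun p : G × X =>
      ‖f (α p) - v p.2‖ₑ ^ (2 : ENNReal).toReal) ?_
    refine Measurable.pow_const (Measurable.enorm ?_) _
    exact ((Lp.stronglyMeasurable f).measurable.comp hα.measurable).sub
      ((Lp.stronglyMeasurable v).measurable.comp measurable_snd)
  have heq : ∀ g, ‖koopman hα g f - v‖ =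
      (eLpNorm (fun x => f (α (g, x)) - v x) 2 lam).toReal := by
    intro g
    rw [Lp.norm_def]
    congr 1
    refine eLpNorm_congr_ae ?_
    filter_upwards [coeFn_koopman hα g f, Lp.coeFn_sub (koopman hα g f) v] with x h1 h2
    rw [h2, Pi.sub_apply, h1]
  simp_rw [heq]
  exact measurableSet_lt hm.ennreal_toReal measurable_const

/-- A Borel action of a Baire group has a continuous Koopman representation. -/
theorem eventually_norm_koopman_sub_lt [TopologicalSpace G] [IsTopologicalGroup G] [BaireSpace G]
    [BorelSpace G] [MeasurableSpace.CountablyGenerated X] [SigmaFinite lam]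
    (hα : IsBooleanAction α lam) (f : Lp ℝ 2 lam) {ε : ℝ} (hε : 0 < ε) :
    ∀ᶠ g in 𝓝 (1 : G), ‖koopman hα g f - f‖ < ε := by
  have : Fact ((2 : ENNReal) ≠ ⊤) := ⟨ENNReal.ofNat_ne_top⟩
  obtain ⟨v, hv⟩ := TopologicalSpace.exists_dense_seq (Lp ℝ 2 lam)
  -- Countably many balls of radius `ε / 2` cover L², so their preimages cover `G` and cannot all be
  -- meagre.
  obtain ⟨j, hj⟩ : ∃ j, ¬ IsMeagre {g | ‖koopman hα g f - v j‖ < ε / 2} := by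
    by_contra! hcon
    have huniv : (⋃ j, {g | ‖koopman hα g f - v j‖ < ε / 2}) = univ := by
      refine eq_univ_of_forall fun g => mem_iUnion.2 ?_
      obtain ⟨j, hj⟩ := hv.exists_dist_lt (koopman hα g f) (half_pos hε)
      exact ⟨j, by simpa [dist_eq_norm] using hj⟩
    have hm : IsMeagre (univ : Set G) := huniv ▸ isMeagre_iUnion hcon
    exact not_isMeagre_of_isOpen isOpen_univ univ_nonempty hm
  filter_upwards [eventually_exists_mul_mem_of_not_isMeagre
    (measurableSet_norm_koopman_sub_lt hα f (v j) (ε / 2)) hj] with g ⟨a, ha, hga⟩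
  replace ha : ‖koopman hα a f - v j‖ < ε / 2 := ha
  replace hga : ‖koopman hα (g * a) f - v j‖ < ε / 2 := hga
  rw [koopman_mul] at hga
  -- Applying the isometry of `a` compares the vectors of `g * a` and `a`, both within `ε / 2` of `v
  -- j`.
  rw [← (koopman hα a).norm_map, map_sub]
  calc ‖koopman hα a (koopman hα g f) - koopman hα a f‖
      = ‖(koopman hα a (koopman hα g f) - v j) - (koopman hα a f - v j)‖ := by congr 1; abel
    _ ≤ ‖koopman hα a (koopman hα g f) - v j‖ + ‖koopman hα a f - v j‖ := norm_sub_le _ _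
    _ < ε := by linarith

end Koopman

/-! ### Covering numbers and an invariant Radon measure -/

section InvariantMeasure

open scoped NNReal ENNReal
open Metric

variable {Z : Type*}

theorem externalCoveringNumber_union_le [PseudoEMetricSpace Z] (r : ℝ≥0) (A B : Set Z) :
    externalCoveringNumber r (A ∪ B) ≤
      externalCoveringNumber r A + externalCoveringNumber r B := by
  simp only [externalCoveringNumber, ENat.iInf_add, ENat.add_iInf]
  refine le_iInf fun D => le_iInf fun hD => le_iInf fun C => le_iInf fun hC => ?_
  refine (iInf₂_le (C ∪ D) ?_).trans (encard_union_le C D)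
  rintro x (hx | hx)
  · obtain ⟨y, hy, hxy⟩ := hC hx
    exact ⟨y, Or.inl hy, hxy⟩
  · obtain ⟨y, hy, hxy⟩ := hD hx
    exact ⟨y, Or.inr hy, hxy⟩

theorem externalCoveringNumber_biUnion_le [PseudoEMetricSpace Z] {ι : Type*} (r : ℝ≥0)
    (s : Finset ι) (A : ι → Set Z) (n : ℕ∞) (h : ∀ i ∈ s, externalCoveringNumber r (A i) ≤ n) :
    externalCoveringNumber r (⋃ i ∈ s, A i) ≤ s.card * n := by
  classical
  induction s using Finset.induction_on with
  | empty => simp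
  | insert a s ha ih =>
    rw [Finset.set_biUnion_insert, Finset.card_insert_of_notMem ha]
    refine (externalCoveringNumber_union_le _ _ _).trans ?_
    push_cast
    rw [add_mul, one_mul, add_comm]
    exact add_le_add (ih fun i hi => h i (Finset.mem_insert_of_mem hi))
      (h a (Finset.mem_insert_self a s))

/-- No centre can serve both sets when they are more than `2 * r` apart. This yields additivity of
the limiting content on disjoint compact sets. -/
theorem externalCoveringNumber_add_le_union [PseudoEMetricSpace Z] {r : ℝ≥0} {A B : Set Z}
    (h : ∀ x ∈ A, ∀ y ∈ B, 2 * (r : ℝ≥0∞) < edist x y) :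
    externalCoveringNumber r A + externalCoveringNumber r B ≤
      externalCoveringNumber r (A ∪ B) := by
  refine le_iInf fun C => le_iInf fun hC => ?_
  have hA : IsCover r A {c ∈ C | ∃ x ∈ A, edist x c ≤ r} := fun x hx => by
    obtain ⟨y, hy, hxy⟩ := hC (Or.inl hx)
    exact ⟨y, ⟨hy, x, hx, hxy⟩, hxy⟩
  have hB : IsCover r B {c ∈ C | ∃ x ∈ B, edist x c ≤ r} := fun x hx => by
    obtain ⟨y, hy, hxy⟩ := hC (Or.inr hx)
    exact ⟨y, ⟨hy, x, hx, hxy⟩, hxy⟩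
  refine (add_le_add hA.externalCoveringNumber_le_encard
    hB.externalCoveringNumber_le_encard).trans ?_
  rw [← encard_union_eq]
  · exact encard_le_encard (union_subset (sep_subset _ _) (sep_subset _ _))
  · rw [disjoint_left]
    rintro c ⟨_, x, hx, hxc⟩ ⟨_, y, hy, hyc⟩
    refine (h x hx y hy).not_ge ?_
    rw [two_mul]
    exact (edist_triangle_right x y c).trans (add_le_add hxc hyc)

theorem externalCoveringNumber_image_le [PseudoEMetricSpace Z] (r : ℝ≥0) (g : Z ≃ᵢ Z)
    (A : Set Z) : externalCoveringNumber r (g '' A) ≤ externalCoveringNumber r A := by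
  refine le_iInf fun C => le_iInf fun hC => ?_
  refine ((g.isometry.isCover_image_iff C).2 hC).externalCoveringNumber_le_encard.trans ?_
  exact encard_image_le _ _

theorem externalCoveringNumber_image [PseudoEMetricSpace Z] (r : ℝ≥0) (g : Z ≃ᵢ Z)
    (A : Set Z) : externalCoveringNumber r (g '' A) = externalCoveringNumber r A := by
  refine (externalCoveringNumber_image_le r g A).antisymm ?_
  have := externalCoveringNumber_image_le r g.symm (g '' A)
  rwa [← image_comp, show (g.symm ∘ g : Z → Z) = id from funext g.symm_apply_apply,
    image_id] at this

theorem externalCoveringNumber_ne_top [PseudoEMetricSpace Z] {r : ℝ≥0} (hr : r ≠ 0) {A : Set Z}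
    (hA : IsCompact A) : externalCoveringNumber r A ≠ ⊤ := by
  obtain ⟨N, _, hN, hc⟩ := exists_finite_isCover_of_isCompact hr hA
  exact ne_top_of_le_ne_top hN.encard_lt_top.ne hc.externalCoveringNumber_le_encard

/-- A locally compact metric space in which some orbit of the isometry group is dense carries
a non-zero Radon measure that is invariant under all isometries. -/
theorem exists_isometry_invariant_measure [MetricSpace Z] [LocallyCompactSpace Z]
    [MeasurableSpace Z] [BorelSpace Z] {z₀ : Z} (hz : Dense (range fun g : Z ≃ᵢ Z => g z₀))
    {K₀ : Set Z} (hK₀ : IsCompact K₀) (hK₀n : K₀ ∈ 𝓝 z₀) :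
    ∃ η : Measure Z, η.Regular ∧ (∀ g : Z ≃ᵢ Z, MeasurePreserving g η η) ∧ 1 ≤ η K₀ := by
  -- An ultrafilter finer than `r → 0+` makes every normalised covering number converge in the
  -- compact space `[0, ∞]`.
  let U : Ultrafilter ℝ≥0 := Ultrafilter.of (𝓝[>] 0)
  have hU : (U : Filter ℝ≥0) ≤ 𝓝[>] 0 := Ultrafilter.of_le _
  have hU0 : ∀ᶠ r in (U : Filter ℝ≥0), r ≠ 0 := by
    filter_upwards [hU self_mem_nhdsWithin] with r hr
    exact hr.ne'
  let c : ℝ≥0 → Set Z → ℝ≥0∞ := fun r K =>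
    (externalCoveringNumber r K : ℝ≥0∞) / (externalCoveringNumber r K₀ : ℝ≥0∞)
  have hlim : ∀ K : Set Z, ∃ l : ℝ≥0∞, Tendsto (fun r => c r K) U (𝓝 l) := by
    intro K
    obtain ⟨l, _, hl⟩ := isCompact_univ.ultrafilter_le_nhds (U.map fun r => c r K) (by simp)
    exact ⟨l, hl⟩
  choose L hL using hlim
  have hn0 : ∀ r, (externalCoveringNumber r K₀ : ℝ≥0∞) ≠ 0 := by
    intro r
    have : K₀.Nonempty := ⟨z₀, mem_of_mem_nhds hK₀n⟩
    simpa using this.ne_empty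
  have hntop : ∀ r : ℝ≥0, r ≠ 0 → (externalCoveringNumber r K₀ : ℝ≥0∞) ≠ ⊤ := by
    intro r hr
    simpa using externalCoveringNumber_ne_top hr hK₀
  have hself : ∀ r : ℝ≥0, r ≠ 0 → c r K₀ = 1 := fun r hr =>
    ENNReal.div_self (hn0 r) (hntop r hr)
  have hLK₀ : L K₀ = 1 := by
    refine tendsto_nhds_unique (hL K₀) (tendsto_const_nhds.congr' ?_)
    filter_upwards [hU0] with r hr
    exact (hself r hr).symm
  have hLtop : ∀ K : Set Z, IsCompact K → L K ≠ ⊤ := by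
    intro K hK
    -- Density of the orbit lets translates of the interior of `K₀` cover `K`; the number of
    -- translates used bounds the content of `K`.
    obtain ⟨t, ht⟩ := hK.elim_finite_subcover (fun g : Z ≃ᵢ Z => g '' interior K₀)
      (fun g => g.toHomeomorph.isOpenMap _ isOpen_interior) (by
        intro x _
        obtain ⟨ρ, hρ, hball⟩ := Metric.mem_nhds_iff.1 (interior_mem_nhds.2 hK₀n)
        obtain ⟨_, ⟨g, rfl⟩, hg⟩ := hz.exists_dist_lt x hρ
        refine mem_iUnion.2 ⟨g, g.symm x, hball ?_, g.apply_symm_apply x⟩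
        rwa [Metric.mem_ball, ← g.dist_eq, g.apply_symm_apply])
    have hb : ∀ r : ℝ≥0, r ≠ 0 → c r K ≤ t.card := by
      intro r hr
      refine ENNReal.div_le_of_le_mul ?_
      have h1 := externalCoveringNumber_biUnion_le r t (fun g : Z ≃ᵢ Z => g '' K₀) _
        fun g _ => (externalCoveringNumber_image r g K₀).le
      have h2 : externalCoveringNumber r K ≤ t.card * externalCoveringNumber r K₀ :=
        (externalCoveringNumber_mono_set (ht.trans
          (iUnion₂_mono fun g _ => image_mono interior_subset))).trans h1
      exact_mod_cast ENat.toENNReal_mono h2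
    have : L K ≤ t.card := by
      refine le_of_tendsto (hL K) ?_
      filter_upwards [hU0] with r hr
      exact hb r hr
    exact ne_top_of_le_ne_top (ENNReal.natCast_ne_top _) this
  have hLmono : ∀ {K K' : Set Z}, K ⊆ K' → L K ≤ L K' := by
    intro K K' h
    refine le_of_tendsto_of_tendsto' (hL K) (hL K') fun r => ?_
    exact ENNReal.div_le_div_right (ENat.toENNReal_mono (externalCoveringNumber_mono_set h)) _
  have hLunion : ∀ K K' : Set Z, L (K ∪ K') ≤ L K + L K' := by
    intro K K'
    refine le_of_tendsto_of_tendsto' (hL _) ((hL K).add (hL K')) fun r => ?_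
    rw [← ENNReal.add_div]
    refine ENNReal.div_le_div_right ?_ _
    exact_mod_cast ENat.toENNReal_mono (externalCoveringNumber_union_le r K K')
  have hLdisj : ∀ K K' : Set Z, IsCompact K → IsCompact K' → Disjoint K K' →
      L (K ∪ K') = L K + L K' := by
    intro K K' hK hK' hd
    refine (hLunion K K').antisymm ?_
    obtain ⟨ρ, hρ, hρd⟩ := Metric.exists_pos_forall_lt_edist hK hK'.isClosed hd
    have hsmall : ∀ᶠ r in (U : Filter ℝ≥0), r < ρ / 2 :=
      hU (nhdsWithin_le_nhds (Iio_mem_nhds (half_pos hρ)))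
    refine le_of_tendsto_of_tendsto ((hL K).add (hL K')) (hL _) ?_
    filter_upwards [hsmall] with r hr
    rw [← ENNReal.add_div]
    refine ENNReal.div_le_div_right ?_ _
    refine (ENat.toENNReal_add _ _).symm.le.trans
      (ENat.toENNReal_mono (externalCoveringNumber_add_le_union fun x hx y hy => ?_))
    refine lt_of_le_of_lt ?_ (hρd x hx y hy)
    have : 2 * r ≤ ρ := by
      rw [mul_comm]
      exact ((lt_div_iff₀ two_pos).1 hr).le
    exact_mod_cast this
  let μ : Content Z :=
    { toFun := fun K => (L K).toNNReal
      mono' := fun K₁ K₂ h => ENNReal.toNNReal_mono (hLtop _ K₂.isCompact) (hLmono h)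
      sup_disjoint' := fun K₁ K₂ h _ _ => by
        rw [TopologicalSpace.Compacts.coe_sup, hLdisj _ _ K₁.isCompact K₂.isCompact h,
          ENNReal.toNNReal_add (hLtop _ K₁.isCompact) (hLtop _ K₂.isCompact)]
      sup_le' := fun K₁ K₂ => by
        rw [TopologicalSpace.Compacts.coe_sup,
          ← ENNReal.toNNReal_add (hLtop _ K₁.isCompact) (hLtop _ K₂.isCompact)]
        exact ENNReal.toNNReal_mono (ENNReal.add_ne_top.2
          ⟨hLtop _ K₁.isCompact, hLtop _ K₂.isCompact⟩) (hLunion _ _) }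
  have hμ : ∀ K : TopologicalSpace.Compacts Z, μ K = L K := fun K =>
    ENNReal.coe_toNNReal (hLtop _ K.isCompact)
  refine ⟨μ.measure, inferInstance, fun g => ⟨g.continuous.measurable, ?_⟩, ?_⟩
  · ext s hs
    rw [Measure.map_apply g.continuous.measurable hs, μ.measure_apply hs,
      μ.measure_apply (g.continuous.measurable hs)]
    refine μ.outerMeasure_preimage g.toHomeomorph (fun K => ?_) s
    rw [hμ, hμ]
    refine tendsto_nhds_unique (hL _) ((hL K).congr fun r => ?_)
    change _ = c r (g '' K)
    simp only [c]
    rw [externalCoveringNumber_image]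
  · rw [μ.measure_apply hK₀.measurableSet]
    have := μ.le_outerMeasure_compacts ⟨K₀, hK₀⟩
    rwa [hμ, TopologicalSpace.Compacts.coe_mk, hLK₀] at this

end InvariantMeasure

/-! ### Minimal norm vectors and equivariant selection -/

section MinimalNorm

theorem measurable_of_measurableSet_norm_sub_lt {E : Type*} [NormedAddCommGroup E]
    [SecondCountableTopology E] [MeasurableSpace E]
    [BorelSpace E] {Z : Type*} [MeasurableSpace Z] {F : Z → E}
    (h : ∀ (v : E) (s : ℝ), MeasurableSet {z | ‖F z - v‖ < s}) : Measurable F := by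
  have hb : TopologicalSpace.IsTopologicalBasis {s : Set E | ∃ v r, s = Metric.ball v r} := by
    refine TopologicalSpace.isTopologicalBasis_of_isOpen_of_nhds ?_ fun a u ha hu => ?_
    · rintro _ ⟨v, r, rfl⟩
      exact Metric.isOpen_ball
    · obtain ⟨r, hr, hru⟩ := Metric.isOpen_iff.1 hu a ha
      exact ⟨_, ⟨a, r, rfl⟩, Metric.mem_ball_self hr, hru⟩
  rw [BorelSpace.measurable_eq (α := E), hb.borel_eq_generateFrom]
  refine measurable_generateFrom ?_
  rintro _ ⟨v, r, rfl⟩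
  have : F ⁻¹' Metric.ball v r = {z | ‖F z - v‖ < r} := by
    ext z
    simp [dist_eq_norm]
  rw [this]
  exact h v r

variable {E : Type*} [NormedAddCommGroup E] [InnerProductSpace ℝ E]

theorem exists_forall_norm_le_of_isClosed_convex [CompleteSpace E] {K : Set E} (hne : K.Nonempty)
    (hcl : IsClosed K) (hconv : Convex ℝ K) : ∃ v ∈ K, ∀ w ∈ K, ‖v‖ ≤ ‖w‖ := by
  obtain ⟨v, hv, hmin⟩ := exists_norm_eq_iInf_of_complete_convex hne hcl.isComplete hconv 0
  refine ⟨v, hv, fun w hw => ?_⟩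
  have h := ciInf_le (⟨0, forall_mem_range.2 fun _ => norm_nonneg _⟩ :
    BddBelow (range fun w : K => ‖(0 : E) - w‖)) ⟨w, hw⟩
  rw [← hmin] at h
  simpa using h

/-- The angle at the projection of `0` onto `K` is not acute. Quantitatively, nearly minimal vectors
are near the minimiser. -/
theorem norm_sub_sq_add_norm_sq_le {K : Set E} (hconv : Convex ℝ K) {v w : E} (hv : v ∈ K)
    (hmin : ∀ w ∈ K, ‖v‖ ≤ ‖w‖) (hw : w ∈ K) : ‖w - v‖ ^ 2 + ‖v‖ ^ 2 ≤ ‖w‖ ^ 2 := by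
  have : Nonempty K := ⟨⟨v, hv⟩⟩
  have h := (norm_eq_iInf_iff_real_inner_le_zero (u := (0 : E)) hconv hv).1 (by
    refine le_antisymm (le_ciInf fun x => ?_) (ciInf_le (⟨0, forall_mem_range.2 fun _ =>
      norm_nonneg _⟩ : BddBelow (range fun w : K => ‖(0 : E) - w‖)) ⟨v, hv⟩)
    simpa using hmin x x.2) w hw
  rw [zero_sub, inner_neg_left] at h
  have h2 := norm_add_sq_real v (w - v)
  rw [add_sub_cancel] at h2
  linarith

theorem eq_of_forall_norm_le {K : Set E} (hconv : Convex ℝ K) {v w : E} (hv : v ∈ K)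
    (hmin : ∀ w ∈ K, ‖v‖ ≤ ‖w‖) (hw : w ∈ K) (hwv : ‖w‖ ≤ ‖v‖) : w = v := by
  have h := norm_sub_sq_add_norm_sq_le hconv hv hmin hw
  have h2 : ‖w‖ ^ 2 ≤ ‖v‖ ^ 2 := by gcongr
  have h3 : ‖w - v‖ ^ 2 ≤ 0 := by linarith
  exact sub_eq_zero.1 (norm_eq_zero.1 (pow_eq_zero_iff two_ne_zero |>.1
    (le_antisymm h3 (sq_nonneg _))))

/-- The minimal norm selection of a family of closed convex hulls is measurable as soon as the
family depends on the parameter in a lower semicontinuous way. -/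
theorem measurable_minimal_norm_selection [SecondCountableTopology E] [MeasurableSpace E]
    [BorelSpace E] {Z : Type*} [TopologicalSpace Z] [MeasurableSpace Z] [BorelSpace Z]
    {C : Z → Set E} (hC : ∀ k, IsOpen {z | k ∈ C z}) (hconv : ∀ z, Convex ℝ (C z))
    {F : Z → E} (hF : ∀ z, F z ∈ closure (C z)) (hmin : ∀ z, ∀ w ∈ closure (C z), ‖F z‖ ≤ ‖w‖) :
    Measurable F := by
  have hopen : ∀ (a s : ℝ) (v : E), IsOpen {z | ∃ k ∈ C z, ‖k‖ < a ∧ ‖k - v‖ < s} := by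
    intro a s v
    have : {z | ∃ k ∈ C z, ‖k‖ < a ∧ ‖k - v‖ < s} =
        ⋃ (k : E) (_ : ‖k‖ < a ∧ ‖k - v‖ < s), {z | k ∈ C z} := by
      ext z
      simp only [mem_ofPred_eq, mem_iUnion, exists_prop]
      exact exists_congr fun k => and_comm
    rw [this]
    exact isOpen_iUnion fun k => isOpen_iUnion fun _ => hC k
  have happrox : ∀ z (a s : ℝ) (v : E), ‖F z‖ < a → ‖F z - v‖ < s →
      ∃ k ∈ C z, ‖k‖ < a ∧ ‖k - v‖ < s := by
    intro z a s v ha hs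
    have ho : IsOpen {k : E | ‖k‖ < a ∧ ‖k - v‖ < s} :=
      (isOpen_lt continuous_norm continuous_const).inter
        (isOpen_lt (continuous_id.sub continuous_const).norm continuous_const)
    obtain ⟨k, hk, hkC⟩ := mem_closure_iff.1 (hF z) _ ho ⟨ha, hs⟩
    exact ⟨k, hkC, hk⟩
  have hnorm : Measurable fun z => ‖F z‖ := by
    refine measurable_of_Iio fun a => ?_
    have : (fun z => ‖F z‖) ⁻¹' Iio a =
        -- The bound by `n` is vacuous in the union; it only brings the set into the form of
        -- `hopen`.
        ⋃ n : ℕ, {z | ∃ k ∈ C z, ‖k‖ < a ∧ ‖k - 0‖ < (n : ℝ)} := by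
      ext z
      simp only [mem_preimage, mem_Iio, mem_iUnion, mem_ofPred_eq]
      constructor
      · intro h
        obtain ⟨n, hn⟩ := exists_nat_gt ‖F z - 0‖
        exact ⟨n, happrox z a n 0 h hn⟩
      · rintro ⟨n, k, hk, hka, _⟩
        exact (hmin z k (subset_closure hk)).trans_lt hka
    rw [this]
    exact MeasurableSet.iUnion fun n => (hopen _ _ _).measurableSet
  refine measurable_of_measurableSet_norm_sub_lt fun v s => ?_
  -- The minimiser is a limit of vectors of `C z` whose norms tend to the minimum, so its distance
  -- to `v` can be tested on nearly minimal vectors, at excess `1 / (m + 1)`.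
  have : {z | ‖F z - v‖ < s} = ⋃ (q : ℚ) (_ : (q : ℝ) < s), ⋂ m : ℕ, ⋃ p : ℚ,
      ({z | (p : ℝ) < ‖F z‖ + 1 / ((m : ℝ) + 1)} ∩ {z | ∃ k ∈ C z, ‖k‖ < p ∧ ‖k - v‖ < q}) := by
    ext z
    simp only [mem_ofPred_eq, mem_iUnion, mem_iInter, mem_inter_iff, exists_prop]
    constructor
    · intro h
      obtain ⟨q, hq, hqs⟩ := exists_rat_btwn h
      refine ⟨q, hqs, fun m => ?_⟩
      obtain ⟨p, hp, hpm⟩ := exists_rat_btwn (show ‖F z‖ < ‖F z‖ + 1 / ((m : ℝ) + 1) from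
        lt_add_of_pos_right _ Nat.one_div_pos_of_nat)
      exact ⟨p, hpm, happrox z p q v hp hq⟩
    · rintro ⟨q, hqs, h⟩
      refine lt_of_le_of_lt ?_ hqs
      choose p hp k hkC hkp hkq using h
      have hlim : Tendsto (fun m : ℕ => ‖F z‖ + 1 / ((m : ℝ) + 1)) atTop (𝓝 (‖F z‖ + 0)) :=
        tendsto_const_nhds.add tendsto_one_div_add_atTop_nhds_zero_nat
      rw [add_zero] at hlim
      have hlim2 : Tendsto (fun m : ℕ => √((‖F z‖ + 1 / ((m : ℝ) + 1)) ^ 2 - ‖F z‖ ^ 2)) atTop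
          (𝓝 0) := by
        have := ((hlim.pow 2).sub_const (‖F z‖ ^ 2)).sqrt
        simpa using this
      have hle : ∀ m : ℕ, ‖F z - v‖ ≤ √((‖F z‖ + 1 / ((m : ℝ) + 1)) ^ 2 - ‖F z‖ ^ 2) + q := by
        intro m
        have h1 := norm_sub_sq_add_norm_sq_le (hconv z).closure (hF z) (hmin z)
          (subset_closure (hkC m))
        have h2 : ‖k m‖ ^ 2 ≤ (‖F z‖ + 1 / ((m : ℝ) + 1)) ^ 2 := by
          gcongr
          exact ((hkp m).trans (hp m)).le
        have h3 : ‖k m - F z‖ ≤ √((‖F z‖ + 1 / ((m : ℝ) + 1)) ^ 2 - ‖F z‖ ^ 2) :=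
          Real.le_sqrt_of_sq_le (by linarith)
        calc ‖F z - v‖ ≤ ‖F z - k m‖ + ‖k m - v‖ := norm_sub_le_norm_sub_add_norm_sub _ _ _
          _ ≤ _ := by
            rw [norm_sub_rev]
            exact add_le_add h3 (hkq m).le
      have := ge_of_tendsto' (hlim2.add_const (q : ℝ)) hle
      simpa using this
  rw [this]
  refine MeasurableSet.iUnion fun q => MeasurableSet.iUnion fun _ => MeasurableSet.iInter fun m =>
    MeasurableSet.iUnion fun p => MeasurableSet.inter ?_ (hopen _ _ _).measurableSet
  exact measurableSet_lt measurable_const (hnorm.add_const _)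

/-- Membership in a hull is witnessed by finitely many points, hence by finitely many open
conditions on `z`. -/
theorem isOpen_setOf_mem_convexHull {Z : Type*} [TopologicalSpace Z] {S : Z → Set E}
    (hS : ∀ k, IsOpen {z | k ∈ S z}) (k : E) : IsOpen {z | k ∈ convexHull ℝ (S z)} := by
  have : {z | k ∈ convexHull ℝ (S z)} =
      ⋃ (t : Finset E) (_ : k ∈ convexHull ℝ (t : Set E)), ⋂ v ∈ t, {z | v ∈ S z} := by
    ext z
    rw [mem_ofPred_eq, convexHull_eq_union_convexHull_finite_subsets]
    simp only [mem_iUnion, mem_iInter, mem_ofPred_eq, exists_prop]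
    exact exists_congr fun t => and_comm
  rw [this]
  exact isOpen_iUnion fun t => isOpen_iUnion fun _ => isOpen_biInter_finset fun v _ => hS v

variable {G Z : Type*} [Group G] [MetricSpace Z] [MulAction G Z]

/-- The translates `T n f` for which `n⁻¹ • z₀` is close to `z`. -/
def nearTranslates (T : G → E →ₗᵢ[ℝ] E) (f : E) (z₀ : Z) (δ : ℝ) (z : Z) : Set E :=
  {v | ∃ n : G, dist (n⁻¹ • z₀) z < δ ∧ T n f = v}

/-- `T g` carries the hull over `z` into the hull over `g⁻¹ • z` and preserves norms; with the same
for `g⁻¹`, uniqueness of the minimiser forces equivariance. -/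
theorem exists_equivariant_selection [CompleteSpace E] [SecondCountableTopology E]
    [MeasurableSpace E] [BorelSpace E] [IsIsometricSMul G Z] [MeasurableSpace Z] [BorelSpace Z]
    (T : G → E →ₗᵢ[ℝ] E) (hT : ∀ g h v, T (g * h) v = T h (T g v))
    (f : E) {z₀ : Z} (hz₀ : Dense (MulAction.orbit G z₀)) {δ : ℝ} (hδ : 0 < δ) :
    ∃ F : Z → E, Measurable F ∧ (∀ g z, T g (F z) = F (g⁻¹ • z)) ∧
      ∀ z, F z ∈ closure (convexHull ℝ (nearTranslates T f z₀ δ z)) := by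
  have hne : ∀ z, (closure (convexHull ℝ (nearTranslates T f z₀ δ z))).Nonempty := by
    intro z
    obtain ⟨_, ⟨g, rfl⟩, hg⟩ := hz₀.exists_dist_lt z hδ
    refine ⟨T g⁻¹ f, subset_closure (subset_convexHull ℝ _ ⟨g⁻¹, ?_, rfl⟩)⟩
    rw [inv_inv, dist_comm]
    exact hg
  have hconv : ∀ z, Convex ℝ (closure (convexHull ℝ (nearTranslates T f z₀ δ z))) := fun z =>
    (convex_convexHull ℝ _).closure
  choose F hF hmin using fun z => exists_forall_norm_le_of_isClosed_convex (hne z) isClosed_closure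
    (hconv z)
  have hmaps : ∀ g z v, v ∈ closure (convexHull ℝ (nearTranslates T f z₀ δ z)) →
      T g v ∈ closure (convexHull ℝ (nearTranslates T f z₀ δ (g⁻¹ • z))) := by
    intro g z v hv
    have h1 : MapsTo (T g) (convexHull ℝ (nearTranslates T f z₀ δ z))
        (convexHull ℝ (nearTranslates T f z₀ δ (g⁻¹ • z))) := by
      rw [mapsTo_iff_image_subset]
      have := (T g).toLinearMap.image_convexHull (nearTranslates T f z₀ δ z)
      rw [LinearIsometry.coe_toLinearMap] at this
      rw [this]
      refine convexHull_mono ?_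
      rintro _ ⟨_, ⟨n, hn, rfl⟩, rfl⟩
      refine ⟨n * g, ?_, hT n g f⟩
      rwa [mul_inv_rev, mul_smul, dist_smul]
    exact h1.closure (T g).continuous hv
  refine ⟨F, ?_, fun g z => ?_, hF⟩
  · refine measurable_minimal_norm_selection (isOpen_setOf_mem_convexHull fun k => ?_)
      (fun z => convex_convexHull ℝ _) hF hmin
    have : {z | k ∈ nearTranslates T f z₀ δ z} =
        ⋃ (n : G) (_ : T n f = k), {z | dist (n⁻¹ • z₀) z < δ} := by
      ext z
      simp only [nearTranslates, mem_ofPred_eq, mem_iUnion, exists_prop]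
      exact exists_congr fun n => and_comm
    rw [this]
    exact isOpen_iUnion fun n => isOpen_iUnion fun _ =>
      isOpen_lt (continuous_const.dist continuous_id) continuous_const
  · refine eq_of_forall_norm_le (hconv _) (hF _) (hmin _) (hmaps g z _ (hF z)) ?_
    rw [(T g).norm_map, ← (T g⁻¹).norm_map (F (g⁻¹ • z))]
    refine hmin z _ ?_
    have := hmaps g⁻¹ (g⁻¹ • z) _ (hF _)
    rwa [inv_inv, smul_inv_smul] at this

end MinimalNorm

/-! ### Sup-norm bounds as closed conditions on L² -/

section Duality

variable {X : Type*} [MeasurableSpace X] {lam : Measure X}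

/-- The elements of `L²` whose integral over each set of finite measure is at most `c` times the
measure of the set. -/
def setIntegralBall (lam : Measure X) (c : ℝ) : Set (Lp ℝ 2 lam) :=
  {k | ∀ s, MeasurableSet s → lam s < ⊤ → |∫ x in s, k x ∂lam| ≤ c * lam.real s}

/-- Expresses the bounds through continuous linear functionals, so that they pass to convex hulls,
closures and vector-valued integrals. -/
theorem setIntegral_eq_inner (k : Lp ℝ 2 lam) {s : Set X} (hs : MeasurableSet s)
    (hμs : lam s < ⊤) :
    ∫ x in s, k x ∂lam = inner ℝ (indicatorConstLp 2 hs hμs.ne (1 : ℝ)) k :=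
  (L2.inner_indicatorConstLp_one (𝕜 := ℝ) hs hμs.ne k).symm

theorem integrableOn_of_measure_lt_top (k : Lp ℝ 2 lam) {s : Set X} (hμs : lam s < ⊤) :
    IntegrableOn k s lam :=
  integrableOn_Lp_of_measure_ne_top k one_le_two hμs.ne

theorem ae_abs_le_of_mem_setIntegralBall [SigmaFinite lam] {k : Lp ℝ 2 lam} {c : ℝ}
    (hk : k ∈ setIntegralBall lam c) : ∀ᵐ x ∂lam, |k x| ≤ c := by
  have hint : ∀ s, lam s < ⊤ → IntegrableOn (fun _ => c) s lam := fun s hs =>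
    integrableOn_const hs.ne
  have h1 : 0 ≤ᵐ[lam] fun x => c - k x := by
    refine ae_nonneg_of_forall_setIntegral_nonneg_of_sigmaFinite (fun s _ hμs =>
      (hint s hμs).sub (integrableOn_of_measure_lt_top k hμs)) fun s hs hμs => ?_
    rw [integral_sub (hint s hμs) (integrableOn_of_measure_lt_top k hμs), setIntegral_const,
      smul_eq_mul, mul_comm]
    linarith [(abs_le.1 (hk s hs hμs)).2]
  have h2 : 0 ≤ᵐ[lam] fun x => c + k x := by
    refine ae_nonneg_of_forall_setIntegral_nonneg_of_sigmaFinite (fun s _ hμs =>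
      (hint s hμs).add (integrableOn_of_measure_lt_top k hμs)) fun s hs hμs => ?_
    rw [integral_add (hint s hμs) (integrableOn_of_measure_lt_top k hμs), setIntegral_const,
      smul_eq_mul, mul_comm]
    linarith [(abs_le.1 (hk s hs hμs)).1]
  filter_upwards [h1, h2] with x hx1 hx2
  simp only [Pi.zero_apply] at hx1 hx2
  exact abs_le.2 ⟨by linarith, by linarith⟩

theorem mem_setIntegralBall_of_ae_abs_le {k : Lp ℝ 2 lam} {c : ℝ}
    (hk : ∀ᵐ x ∂lam, |k x| ≤ c) : k ∈ setIntegralBall lam c := by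
  intro s hs hμs
  exact norm_setIntegral_le_of_norm_le_const_ae' hμs
    (hk.mono fun x hx _ => (Real.norm_eq_abs (k x)).trans_le hx)

theorem convex_setIntegralBall (c : ℝ) : Convex ℝ (setIntegralBall lam c) := by
  intro k hk l hl a b ha hb hab s hs hμs
  have h1 := hk s hs hμs
  have h2 := hl s hs hμs
  rw [setIntegral_eq_inner _ hs hμs] at h1 h2 ⊢
  rw [inner_add_right, inner_smul_right, inner_smul_right]
  calc |a * inner ℝ _ k + b * inner ℝ _ l| ≤ |a * inner ℝ _ k| + |b * inner ℝ _ l| :=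
        abs_add_le _ _
    _ = a * |inner ℝ _ k| + b * |inner ℝ _ l| := by
        rw [abs_mul, abs_mul, abs_of_nonneg ha, abs_of_nonneg hb]
    _ ≤ a * (c * lam.real s) + b * (c * lam.real s) := by gcongr
    _ = c * lam.real s := by rw [← add_mul, hab, one_mul]

theorem isClosed_setIntegralBall (c : ℝ) : IsClosed (setIntegralBall lam c) := by
  have : setIntegralBall lam c = ⋂ (s : Set X) (hs : MeasurableSet s) (hμs : lam s < ⊤),
      {k | |inner ℝ (indicatorConstLp 2 hs hμs.ne (1 : ℝ)) k| ≤ c * lam.real s} := by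
    ext k
    simp only [setIntegralBall, mem_ofPred_eq, mem_iInter]
    refine forall_congr' fun s => forall_congr' fun hs => forall_congr' fun hμs => ?_
    rw [setIntegral_eq_inner _ hs hμs]
  rw [this]
  refine isClosed_iInter fun s => isClosed_iInter fun hs => isClosed_iInter fun hμs => ?_
  exact isClosed_le (continuous_const.inner continuous_id).abs continuous_const

/-- The functionals commute with the integral, so an L¹ bound on the weight becomes a sup bound on
the average. -/
theorem integral_smul_mem_setIntegralBall {Z : Type*} [MeasurableSpace Z] {η : Measure Z}
    {F : Z → Lp ℝ 2 lam} (hF : ∀ z, F z ∈ setIntegralBall lam 1) {ψ : Z → ℝ}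
    (hψ : Integrable ψ η) (hψF : Integrable (fun z => ψ z • F z) η) :
    ∫ z, ψ z • F z ∂η ∈ setIntegralBall lam (∫ z, |ψ z| ∂η) := by
  intro s hs hμs
  rw [setIntegral_eq_inner _ hs hμs, ← integral_inner hψF, ← integral_mul_const,
    ← Real.norm_eq_abs]
  refine norm_integral_le_of_norm_le (hψ.abs.mul_const _) (ae_of_all _ fun z => ?_)
  rw [inner_smul_right, norm_mul, Real.norm_eq_abs, Real.norm_eq_abs]
  refine mul_le_mul_of_nonneg_left ?_ (abs_nonneg _)
  have := hF z s hs hμs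
  rwa [one_mul, setIntegral_eq_inner _ hs hμs] at this

end Duality

/-! ### Averaging against a bump function -/

section Smoothing

variable {G Z : Type*} [Group G] [MetricSpace Z] [MulAction G Z]

/-- The bump function of radius `δ` at `z₀`. -/
noncomputable def bump (z₀ : Z) (δ : ℝ) (z : Z) : ℝ := max 0 (δ - dist z z₀)

theorem continuous_bump (z₀ : Z) (δ : ℝ) : Continuous (bump z₀ δ) :=
  continuous_const.max (continuous_const.sub (continuous_id.dist continuous_const))

theorem bump_nonneg (z₀ : Z) (δ : ℝ) (z : Z) : 0 ≤ bump z₀ δ z := le_max_left _ _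

theorem bump_eq_zero {z₀ z : Z} {δ : ℝ} (h : δ ≤ dist z z₀) : bump z₀ δ z = 0 :=
  max_eq_left (by linarith)

theorem hasCompactSupport_bump {z₀ : Z} {δ : ℝ} (h : IsCompact (Metric.closedBall z₀ δ)) :
    HasCompactSupport (bump z₀ δ) :=
  HasCompactSupport.intro h fun z hz => bump_eq_zero (by
    rw [Metric.mem_closedBall, not_le] at hz
    exact hz.le)

theorem abs_bump_sub_bump_le (z₀ z w : Z) (δ : ℝ) :
    |bump z₀ δ z - bump z₀ δ w| ≤ |dist z z₀ - dist w z₀| := by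
  refine (abs_max_sub_max_le_max _ _ _ _).trans ?_
  rw [sub_self, abs_zero, max_eq_right (abs_nonneg _), abs_sub_comm]
  apply le_of_eq
  congr 1
  ring

/-- The integrand is at most the displacement of `z₀` by `g`, and vanishes unless `z` or `g • z`
lies in the ball; by invariance each case has the measure of the ball. -/
theorem integral_abs_bump_smul_sub_le [IsIsometricSMul G Z] [MeasurableSpace Z] [BorelSpace Z]
    {η : Measure Z} [IsFiniteMeasureOnCompacts η]
    (hη : ∀ g : G, MeasurePreserving (fun z : Z => g • z) η η) {z₀ : Z} {δ : ℝ}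
    (h : IsCompact (Metric.closedBall z₀ δ)) (g : G) :
    ∫ z, |bump z₀ δ (g • z) - bump z₀ δ z| ∂η ≤
      2 * η.real (Metric.closedBall z₀ δ) * dist (g • z₀) z₀ := by
  set B := Metric.closedBall z₀ δ
  have hBm : MeasurableSet B := Metric.isClosed_closedBall.measurableSet
  have hB : Integrable (B.indicator fun _ => (1 : ℝ)) η :=
    (integrable_indicator_iff hBm).2 (integrableOn_const h.measure_lt_top.ne)
  have hBg : Integrable (fun z => B.indicator (fun _ => (1 : ℝ)) (g • z)) η :=
    (hη g).integrable_comp_of_integrable hB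
  have hpt : ∀ z, |bump z₀ δ (g • z) - bump z₀ δ z| ≤
      (B.indicator (fun _ => (1 : ℝ)) (g • z) + B.indicator (fun _ => (1 : ℝ)) z) *
        dist (g • z₀) z₀ := by
    intro z
    have hle : |bump z₀ δ (g • z) - bump z₀ δ z| ≤ dist (g • z₀) z₀ := by
      refine (abs_bump_sub_bump_le _ _ _ _).trans ?_
      have h1 : dist z z₀ = dist (g • z) (g • z₀) := (dist_smul g z z₀).symm
      rw [h1, dist_comm (g • z), dist_comm (g • z)]
      have := abs_dist_sub_le z₀ (g • z₀) (g • z)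
      rwa [dist_comm z₀ (g • z₀)] at this
    by_cases h1 : g • z ∈ B
    · rw [indicator_of_mem h1]
      refine hle.trans (le_mul_of_one_le_left dist_nonneg ?_)
      linarith [indicator_nonneg (fun _ _ => zero_le_one) z (s := B) (f := fun _ => (1 : ℝ))]
    · by_cases h2 : z ∈ B
      · rw [indicator_of_mem h2]
        refine hle.trans (le_mul_of_one_le_left dist_nonneg ?_)
        linarith [indicator_nonneg (fun _ _ => zero_le_one) (g • z) (s := B)
          (f := fun _ => (1 : ℝ))]
      · rw [bump_eq_zero (not_le.1 h1).le, bump_eq_zero (not_le.1 h2).le, sub_self, abs_zero]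
        exact mul_nonneg (add_nonneg (indicator_nonneg (fun _ _ => zero_le_one) _)
          (indicator_nonneg (fun _ _ => zero_le_one) _)) dist_nonneg
  refine (integral_mono_of_nonneg (ae_of_all _ fun z => abs_nonneg _)
    ((hBg.add hB).mul_const _) (ae_of_all _ hpt)).trans_eq ?_
  have hemb : MeasurableEmbedding (fun z : Z => g • z) :=
    (Homeomorph.smul g).measurableEmbedding
  simp only [Pi.add_apply]
  rw [integral_mul_const, integral_add hBg hB,
    (hη g).integral_comp hemb (B.indicator fun _ => (1 : ℝ)), integral_indicator_const _ hBm]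
  simp only [smul_eq_mul, mul_one]
  ring

variable {X : Type*} [MeasurableSpace G] [MeasurableSpace X] {α : G × X → X} {lam : Measure X}

/-- Averaging the minimal norm selection against an invariant measure approximates a vector of
`L²` by functions on which the group acts in a uniformly Lipschitz way. -/
theorem exists_lipschitz_approximation_of_isometric_action [IsIsometricSMul G Z]
    [LocallyCompactSpace Z] [MeasurableSpace.CountablyGenerated X] [SigmaFinite lam]
    (hα : IsBooleanAction α lam) {f : Lp ℝ 2 lam} (hf : ∀ᵐ x ∂lam, |f x| ≤ 1)
    {z₀ : Z} (hz₀ : Dense (MulAction.orbit G z₀)) {δ ε : ℝ} (hδ : 0 < δ)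
    (hcomp : IsCompact (Metric.closedBall z₀ δ))
    (hε : ∀ n : G, dist (n⁻¹ • z₀) z₀ < 2 * δ → ‖koopman hα n f - f‖ ≤ ε) :
    ∃ (f' : Lp ℝ 2 lam) (C : ℝ), 0 ≤ C ∧ ‖f' - f‖ ≤ ε ∧ (∀ᵐ x ∂lam, |f' x| ≤ 1) ∧
      ∀ h : G, ∀ᵐ x ∂lam, |f' (α (h, x)) - f' x| ≤ C * dist (h • z₀) z₀ := by
  have : Fact ((2 : ENNReal) ≠ ⊤) := ⟨ENNReal.ofNat_ne_top⟩
  borelize Z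
  let : MeasurableSpace (Lp ℝ 2 lam) := borel _
  have : BorelSpace (Lp ℝ 2 lam) := ⟨rfl⟩
  obtain ⟨F, hFm, hFeq, hFmem⟩ := exists_equivariant_selection (koopman hα)
    (fun g h v => koopman_mul hα g h v) f hz₀ hδ
  have hdense : Dense (range fun g : Z ≃ᵢ Z => g z₀) := by
    refine hz₀.mono ?_
    rintro _ ⟨g, rfl⟩
    exact ⟨IsometryEquiv.constSMul g, rfl⟩
  have hcomp2 : IsCompact (Metric.closedBall z₀ (δ / 2)) :=
    hcomp.of_isClosed_subset Metric.isClosed_closedBall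
      (Metric.closedBall_subset_closedBall (by linarith))
  obtain ⟨η, hηreg, hηinv, hη1⟩ := exists_isometry_invariant_measure hdense hcomp2
    (Metric.closedBall_mem_nhds z₀ (half_pos hδ))
  have hη : ∀ g : G, MeasurePreserving (fun z : Z => g • z) η η := fun g =>
    hηinv (IsometryEquiv.constSMul g)
  set φ := bump z₀ δ with hφ
  have hφint : Integrable φ η :=
    (continuous_bump z₀ δ).integrable_of_hasCompactSupport (hasCompactSupport_bump hcomp)
  set I := ∫ z, φ z ∂η with hI
  -- On the ball of radius `δ / 2`, of measure at least `1`, the bump is at least `δ / 2`.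
  have hIpos : 0 < I := by
    have hfin : η (Metric.closedBall z₀ (δ / 2)) ≠ ⊤ := hcomp2.measure_lt_top.ne
    have h1 : δ / 2 * η.real (Metric.closedBall z₀ (δ / 2)) ≤ I := by
      rw [mul_comm, ← smul_eq_mul, ← setIntegral_const]
      refine (setIntegral_mono_on (integrableOn_const hfin) hφint.integrableOn
        Metric.isClosed_closedBall.measurableSet fun z hz => ?_).trans
        (setIntegral_le_integral hφint (ae_of_all _ (bump_nonneg z₀ δ)))
      refine le_max_of_le_right ?_
      linarith [Metric.mem_closedBall.1 hz]
    have h2 : 1 ≤ η.real (Metric.closedBall z₀ (δ / 2)) := by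
      rw [measureReal_def, ← ENNReal.toReal_one]
      exact ENNReal.toReal_mono hfin hη1
    nlinarith
  have hFball : ∀ z, F z ∈ setIntegralBall lam 1 := by
    intro z
    refine closure_minimal (convexHull_min ?_ (convex_setIntegralBall 1))
      (isClosed_setIntegralBall 1) (hFmem z)
    rintro _ ⟨n, _, rfl⟩
    refine mem_setIntegralBall_of_ae_abs_le ?_
    filter_upwards [coeFn_koopman hα n f, (hα.measurePreserving n).quasiMeasurePreserving.ae hf]
      with x hx1 hx2
    rwa [hx1]
  have hFnorm : ∀ z, ‖F z‖ ≤ ‖f‖ := by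
    intro z
    have : F z ∈ Metric.closedBall (0 : Lp ℝ 2 lam) ‖f‖ := by
      refine closure_minimal (convexHull_min ?_ (convex_closedBall _ _))
        Metric.isClosed_closedBall (hFmem z)
      rintro _ ⟨n, _, rfl⟩
      simp [(koopman hα n).norm_map]
    simpa using this
  have hFnear : ∀ z, dist z z₀ < δ → ‖F z - f‖ ≤ ε := by
    intro z hz
    have : F z ∈ Metric.closedBall f ε := by
      refine closure_minimal (convexHull_min ?_ (convex_closedBall _ _))
        Metric.isClosed_closedBall (hFmem z)
      rintro _ ⟨n, hn, rfl⟩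
      rw [Metric.mem_closedBall, dist_eq_norm]
      refine hε n ?_
      linarith [dist_triangle (n⁻¹ • z₀) z z₀]
    simpa [dist_eq_norm] using this
  have hFs : AEStronglyMeasurable F η := hFm.aestronglyMeasurable
  have hint : ∀ {ψ : Z → ℝ}, Integrable ψ η → Integrable (fun z => ψ z • F z) η := fun hψ =>
    hψ.smul_bdd ‖f‖ hFs (ae_of_all _ hFnorm)
  have hφh : ∀ h : G, Integrable (fun z => φ (h • z)) η := fun h =>
    (hη h).integrable_comp_of_integrable hφint
  set v := ∫ z, φ z • F z ∂η with hv
  refine ⟨I⁻¹ • v, I⁻¹ * (2 * η.real (Metric.closedBall z₀ δ)), by positivity, ?_, ?_, ?_⟩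
  · have h1 : I⁻¹ • v - f = I⁻¹ • ∫ z, φ z • (F z - f) ∂η := by
      simp_rw [smul_sub]
      rw [integral_sub (hint hφint) (hφint.smul_const f), integral_smul_const, smul_sub, smul_smul,
        inv_mul_cancel₀ hIpos.ne', one_smul]
    have h2 : ‖∫ z, φ z • (F z - f) ∂η‖ ≤ I * ε := by
      rw [hI, ← integral_mul_const]
      refine norm_integral_le_of_norm_le (hφint.mul_const ε) (ae_of_all _ fun z => ?_)
      rw [norm_smul, Real.norm_of_nonneg (bump_nonneg z₀ δ z)]
      rcases lt_or_ge (dist z z₀) δ with hz | hz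
      · exact mul_le_mul_of_nonneg_left (hFnear z hz) (bump_nonneg z₀ δ z)
      · rw [hφ, bump_eq_zero hz, zero_mul, zero_mul]
    rw [h1, norm_smul, norm_inv, Real.norm_of_nonneg hIpos.le, inv_mul_le_iff₀ hIpos]
    exact h2
  · have h1 := ae_abs_le_of_mem_setIntegralBall
      (integral_smul_mem_setIntegralBall hFball hφint (hint hφint))
    filter_upwards [h1, Lp.coeFn_smul I⁻¹ v] with x hx1 hx2
    rw [hx2, Pi.smul_apply, smul_eq_mul, abs_mul, abs_of_pos (inv_pos.2 hIpos),
      inv_mul_le_iff₀ hIpos, mul_one]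
    refine hx1.trans_eq (integral_congr_ae (ae_of_all _ fun z => abs_of_nonneg ?_))
    exact bump_nonneg z₀ δ z
  · intro h
    have hemb : MeasurableEmbedding (fun z : Z => h • z) :=
      (Homeomorph.smul h).measurableEmbedding
    -- Equivariance of `F` and invariance of `η` shift the action of `h` from the vectors to the
    -- weight.
    have h1 : koopman hα h v = ∫ z, φ (h • z) • F z ∂η := by
      rw [hv, ← LinearIsometry.integral_comp_comm, ← (hη h).integral_comp hemb]
      refine integral_congr_ae (ae_of_all _ fun z => ?_)
      simp only [map_smul, hFeq, inv_smul_smul]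
    have h2 : koopman hα h v - v = ∫ z, (φ (h • z) - φ z) • F z ∂η := by
      simp_rw [sub_smul]
      rw [integral_sub (hint (hφh h)) (hint hφint), h1]
    have h3 := ae_abs_le_of_mem_setIntegralBall (integral_smul_mem_setIntegralBall hFball
      ((hφh h).sub hφint) (hint ((hφh h).sub hφint)))
    simp only [Pi.sub_apply] at h3
    rw [← h2] at h3
    have h4 := integral_abs_bump_smul_sub_le hη hcomp h
    have h5 := Lp.coeFn_smul I⁻¹ v
    filter_upwards [h3, Lp.coeFn_sub (koopman hα h v) v, coeFn_koopman hα h v, h5,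
      (hα.measurePreserving h).quasiMeasurePreserving.ae h5] with x hx3 hx4 hx6 hx5 hx7
    rw [hx5, hx7, Pi.smul_apply, Pi.smul_apply, smul_eq_mul, smul_eq_mul, ← mul_sub, abs_mul,
      abs_of_pos (inv_pos.2 hIpos), mul_assoc]
    refine mul_le_mul_of_nonneg_left ?_ (inv_pos.2 hIpos).le
    rw [hx4, Pi.sub_apply, hx6] at hx3
    exact hx3.trans h4

end Smoothing

/-- A continuous pseudo-length function on a topological group. -/
structure IsContinuousLength {G : Type*} [Group G] [TopologicalSpace G] (ρ : G → ℝ) : Prop where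
  map_one : ρ 1 = 0
  map_inv : ∀ g, ρ g⁻¹ = ρ g
  map_mul_le : ∀ g h, ρ (g * h) ≤ ρ g + ρ h
  continuous : Continuous ρ

/-! ### Orbit closures of finite tuples and length functions -/

section OrbitClosure

variable {G W : Type*} [Group G] [MetricSpace W] [MulAction G W] [IsIsometricSMul G W]

theorem smul_mem_closure_orbit {w₀ : W} (g : G) {w : W} (hw : w ∈ closure (MulAction.orbit G w₀)) :
    g • w ∈ closure (MulAction.orbit G w₀) := by
  have h : MapsTo (fun w : W => g • w) (MulAction.orbit G w₀) (MulAction.orbit G w₀) :=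
    fun x hx => MulAction.mem_orbit_of_mem_orbit g hx
  exact h.closure (isometry_smul W g).continuous hw

/-- The action of `G` on the closure of an orbit. -/
@[reducible] def closureOrbitMulAction (G : Type*) {W : Type*} [Group G] [MetricSpace W]
    [MulAction G W] [IsIsometricSMul G W] (w₀ : W) :
    MulAction G (closure (MulAction.orbit G w₀)) where
  smul g w := ⟨g • (w : W), smul_mem_closure_orbit g w.2⟩
  one_smul w := Subtype.ext (one_smul G (w : W))
  mul_smul g h w := Subtype.ext (mul_smul g h (w : W))

theorem isContinuousLength_dist_smul [TopologicalSpace G] (w₀ : W)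
    (hcont : Continuous fun g : G => g • w₀) {C : ℝ} (hC : 0 ≤ C) :
    IsContinuousLength fun g : G => C * dist (g • w₀) w₀ where
  map_one := by simp
  map_inv g := by
    rw [← dist_smul g (g⁻¹ • w₀) w₀, smul_inv_smul, dist_comm]
  map_mul_le g h := by
    rw [← mul_add]
    refine mul_le_mul_of_nonneg_left ?_ hC
    refine (dist_triangle ((g * h) • w₀) (g • w₀) w₀).trans_eq ?_
    rw [mul_smul, dist_smul, add_comm]
  continuous := continuous_const.mul (hcont.dist continuous_const)

end OrbitClosure

instance isometryEquivMulAction (M : Type*) [MetricSpace M] : MulAction (M ≃ᵢ M) M where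
  smul g x := g x
  one_smul _ := rfl
  mul_smul _ _ _ := rfl

instance isometryEquiv_isIsometricSMul (M : Type*) [MetricSpace M] :
    IsIsometricSMul (M ≃ᵢ M) M where
  isometry_smul g := g.isometry

theorem isIsometricSMul_pi (G M ι : Type*) [Group G] [MetricSpace M] [MulAction G M]
    [IsIsometricSMul G M] [Fintype ι] : IsIsometricSMul G (ι → M) where
  isometry_smul g := by
    refine Isometry.of_dist_eq fun x y => ?_
    simp only [dist_pi_def]
    congr 2
    ext i
    simp [nndist_smul]

/-- For a Borel action of the isometry group of a locally compact separable metric space, every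
bounded element of `L²` can be approximated by functions on which the group acts in a uniformly
Lipschitz way with respect to a continuous length function. -/
theorem exists_lipschitz_approximation {M : Type*} [MetricSpace M] [LocallyCompactSpace M]
    [TopologicalSpace.SeparableSpace M] {X : Type*} [MeasurableSpace X]
    [MeasurableSpace.CountablyGenerated X] {lam : Measure X} [SigmaFinite lam]
    {α : (M ≃ᵢ M) × X → X} (hα : IsBooleanAction α lam) {f : Lp ℝ 2 lam}
    (hf : ∀ᵐ x ∂lam, |f x| ≤ 1) {ε : ℝ} (hε : 0 < ε) :
    ∃ (f' : Lp ℝ 2 lam) (ρ : (M ≃ᵢ M) → ℝ), IsContinuousLength ρ ∧ ‖f' - f‖ ≤ ε ∧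
      (∀ᵐ x ∂lam, |f' x| ≤ 1) ∧ ∀ h, ∀ᵐ x ∂lam, |f' (α (h, x)) - f' x| ≤ ρ h := by
  obtain ⟨s, δ, hδ, hs⟩ := exists_finset_isometryEquiv_mem
    (eventually_norm_koopman_sub_lt hα f hε)
  have := isIsometricSMul_pi (M ≃ᵢ M) M s
  let w₀ : s → M := fun x => x
  have hcont : Continuous fun g : M ≃ᵢ M => g • w₀ :=
    continuous_pi fun x => continuous_isometryEquiv_apply (x : M)
  let := closureOrbitMulAction (M ≃ᵢ M) w₀
  have : IsIsometricSMul (M ≃ᵢ M) (closure (MulAction.orbit (M ≃ᵢ M) w₀)) :=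
    ⟨fun g => Isometry.of_dist_eq fun x y => dist_smul g (x : s → M) y⟩
  have : LocallyCompactSpace (closure (MulAction.orbit (M ≃ᵢ M) w₀)) :=
    isClosed_closure.isClosedEmbedding_subtypeVal.locallyCompactSpace
  let z₀ : closure (MulAction.orbit (M ≃ᵢ M) w₀) :=
    ⟨w₀, subset_closure (MulAction.mem_orbit_self w₀)⟩
  have hdense : Dense (MulAction.orbit (M ≃ᵢ M) z₀) := by
    rw [Subtype.dense_iff]
    refine closure_mono ?_
    rintro _ ⟨g, rfl⟩
    exact ⟨g • z₀, ⟨g, rfl⟩, rfl⟩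
  obtain ⟨r, hr, hrc⟩ := Metric.exists_isCompact_closedBall z₀
  -- The bound `r` gives compactness; the bound `δ / 2` ensures that twice the radius is at most
  -- `δ`, as the doubled radius in the approximation hypothesis requires.
  have hcomp : IsCompact (Metric.closedBall z₀ (min r (δ / 2))) :=
    hrc.of_isClosed_subset Metric.isClosed_closedBall
      (Metric.closedBall_subset_closedBall (min_le_left _ _))
  obtain ⟨f', C, hC, hf', hf'1, hf'L⟩ := exists_lipschitz_approximation_of_isometric_action hα hf
    hdense (lt_min hr (half_pos hδ)) hcomp (ε := ε) (fun n hn => by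
      have h1 : n⁻¹ ∈ {g | ‖koopman hα g f - f‖ < ε} := by
        refine hs n⁻¹ fun x hx => ?_
        have h2 : dist (n⁻¹ • w₀) w₀ < δ := by
          refine lt_of_lt_of_le hn ?_
          linarith [min_le_right r (δ / 2)]
        exact (dist_le_pi_dist (n⁻¹ • w₀) w₀ ⟨x, hx⟩).trans_lt h2
      rw [norm_sub_rev, ← (koopman hα n⁻¹).norm_map, map_sub, ← koopman_mul, mul_inv_cancel,
        koopman_one]
      exact le_of_lt h1)
  exact ⟨f', _, isContinuousLength_dist_smul w₀ hcont hC, hf', hf'1, hf'L⟩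

/-! ### The space of Lipschitz families and its translation action -/

section LipschitzModel

variable {G ι : Type*} [Group G]

theorem IsContinuousLength.nonneg [TopologicalSpace G] {ρ : G → ℝ}
    (hρ : IsContinuousLength ρ) (g : G) : 0 ≤ ρ g := by
  have h := hρ.map_mul_le g g⁻¹
  rw [mul_inv_cancel, hρ.map_one, hρ.map_inv] at h
  linarith

/-- Families of functions on `G` with values in `[-1, 1]` which are Lipschitz with respect to given
length functions. -/
def lipschitzFamilies (ρ : ι → G → ℝ) : Set (ι → G → ℝ) :=
  {u | ∀ i g, u i g ∈ Icc (-1 : ℝ) 1 ∧ ∀ h, |u i (h * g) - u i g| ≤ ρ i h}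

theorem isCompact_lipschitzFamilies (ρ : ι → G → ℝ) : IsCompact (lipschitzFamilies ρ) := by
  have hc : IsCompact (Set.pi univ fun _ : ι => Set.pi univ fun _ : G => Icc (-1 : ℝ) 1) :=
    isCompact_univ_pi fun _ => isCompact_univ_pi fun _ => isCompact_Icc
  refine hc.of_isClosed_subset ?_ fun u hu i _ g _ => (hu i g).1
  have hev : ∀ i g, Continuous fun u : ι → G → ℝ => u i g := fun i g =>
    (continuous_apply g).comp (continuous_apply i)
  simp only [lipschitzFamilies, ofPred_forall, ofPred_and]
  exact isClosed_iInter fun i => isClosed_iInter fun g =>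
    (isClosed_Icc.preimage (hev i g)).inter (isClosed_iInter fun h =>
      isClosed_le ((hev i _).sub (hev i g)).abs continuous_const)

instance (ρ : ι → G → ℝ) : CompactSpace (lipschitzFamilies ρ) :=
  isCompact_iff_compactSpace.1 (isCompact_lipschitzFamilies ρ)

theorem rightTranslate_mem_lipschitzFamilies {ρ : ι → G → ℝ} {u : ι → G → ℝ}
    (hu : u ∈ lipschitzFamilies ρ) (k : G) :
    (fun i g => u i (g * k)) ∈ lipschitzFamilies ρ := fun i g =>
  ⟨(hu i (g * k)).1, fun h => by
    simpa only [mul_assoc] using (hu i (g * k)).2 h⟩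

/-- The locally compact space of non-zero Lipschitz families. -/
def NonzeroLipschitzFamily (ρ : ι → G → ℝ) : Type _ :=
  {u : lipschitzFamilies ρ // (u : ι → G → ℝ) ≠ 0}

instance (ρ : ι → G → ℝ) : TopologicalSpace (NonzeroLipschitzFamily ρ) :=
  inferInstanceAs (TopologicalSpace {u : lipschitzFamilies ρ // (u : ι → G → ℝ) ≠ 0})

instance (ρ : ι → G → ℝ) : MeasurableSpace (NonzeroLipschitzFamily ρ) := borel _

instance (ρ : ι → G → ℝ) : BorelSpace (NonzeroLipschitzFamily ρ) := ⟨rfl⟩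

theorem isOpen_nonzero_lipschitzFamilies (ρ : ι → G → ℝ) :
    IsOpen {u : lipschitzFamilies ρ | (u : ι → G → ℝ) ≠ 0} :=
  isOpen_ne_fun continuous_subtype_val continuous_const

instance (ρ : ι → G → ℝ) : LocallyCompactSpace (NonzeroLipschitzFamily ρ) :=
  (isOpen_nonzero_lipschitzFamilies ρ).locallyCompactSpace

/-- The action of `G` on Lipschitz families by right translation. -/
def rightTranslate (ρ : ι → G → ℝ) (p : G × NonzeroLipschitzFamily ρ) :
    NonzeroLipschitzFamily ρ :=
  ⟨⟨fun i g => p.2.1.1 i (g * p.1), rightTranslate_mem_lipschitzFamilies p.2.1.2 p.1⟩, fun h =>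
    p.2.2 (by
      funext i g
      have := congrFun (congrFun h i) (g * p.1⁻¹)
      simpa using this)⟩

variable [TopologicalSpace G] [IsTopologicalGroup G]

theorem eventually_length_mul_inv_lt {ρ : G → ℝ} (hρ : IsContinuousLength ρ) (g : G) {ε : ℝ}
    (hε : 0 < ε) : ∀ᶠ h in 𝓝 g, ρ (h * g⁻¹) < ε := by
  have hc : Continuous fun h => ρ (h * g⁻¹) := hρ.continuous.comp (continuous_mul_const g⁻¹)
  refine hc.continuousAt.eventually_lt continuousAt_const ?_
  rwa [mul_inv_cancel, hρ.map_one]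

theorem continuous_of_mem_lipschitzFamilies {ρ : ι → G → ℝ} (hρ : ∀ i, IsContinuousLength (ρ i))
    {u : ι → G → ℝ} (hu : u ∈ lipschitzFamilies ρ) (i : ι) : Continuous (u i) := by
  refine continuous_iff_continuousAt.2 fun g => Metric.tendsto_nhds.2 fun ε hε => ?_
  filter_upwards [eventually_length_mul_inv_lt (hρ i) g hε] with h hh
  have := (hu i g).2 (h * g⁻¹)
  rw [inv_mul_cancel_right] at this
  exact this.trans_lt hh

theorem eq_of_forall_eq_denseRange {ρ : ι → G → ℝ} (hρ : ∀ i, IsContinuousLength (ρ i))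
    {D : ℕ → G} (hD : DenseRange D) {u v : ι → G → ℝ} (hu : u ∈ lipschitzFamilies ρ)
    (hv : v ∈ lipschitzFamilies ρ) (h : ∀ i n, u i (D n) = v i (D n)) : u = v := by
  funext i
  exact hD.equalizer (continuous_of_mem_lipschitzFamilies hρ hu i)
    (continuous_of_mem_lipschitzFamilies hρ hv i) (funext fun n => h i n)

/-- A continuous injection of a compact space into a Hausdorff one. It reduces the possibly
uncountable product to countably many coordinates when `ι` is countable, whence metrizability. -/
theorem isClosedEmbedding_restrict_denseRange {ρ : ι → G → ℝ}
    (hρ : ∀ i, IsContinuousLength (ρ i)) {D : ℕ → G} (hD : DenseRange D) :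
    IsClosedEmbedding fun (u : lipschitzFamilies ρ) (i : ι) (n : ℕ) => (u : ι → G → ℝ) i (D n) := by
  refine Continuous.isClosedEmbedding ?_ fun u v huv => ?_
  · refine continuous_pi fun i => continuous_pi fun n => ?_
    exact (continuous_apply (D n)).comp ((continuous_apply i).comp continuous_subtype_val)
  · exact Subtype.ext (eq_of_forall_eq_denseRange hρ hD u.2 v.2 fun i n =>
      congrFun (congrFun huv i) n)

theorem polishSpace_lipschitzFamilies [Countable ι] [TopologicalSpace.SeparableSpace G]
    {ρ : ι → G → ℝ} (hρ : ∀ i, IsContinuousLength (ρ i)) :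
    PolishSpace (lipschitzFamilies ρ) :=
  (isClosedEmbedding_restrict_denseRange hρ
    (TopologicalSpace.denseRange_denseSeq G)).polishSpace

theorem polishSpace_nonzeroLipschitzFamily [Countable ι] [TopologicalSpace.SeparableSpace G]
    {ρ : ι → G → ℝ} (hρ : ∀ i, IsContinuousLength (ρ i)) :
    PolishSpace (NonzeroLipschitzFamily ρ) := by
  have := polishSpace_lipschitzFamilies hρ
  exact (isOpen_nonzero_lipschitzFamilies ρ).polishSpace

/-- The Lipschitz bound is the same for all families, so moving the group element is controlled
uniformly in the family; this gives joint continuity. -/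
theorem continuous_rightTranslate {ρ : ι → G → ℝ} (hρ : ∀ i, IsContinuousLength (ρ i)) :
    Continuous (rightTranslate ρ) := by
  refine Continuous.subtype_mk (Continuous.subtype_mk (continuous_pi fun i => continuous_pi
    fun g => continuous_iff_continuousAt.2 fun p => Metric.tendsto_nhds.2 fun ε hε => ?_) _) _
  have hev : Continuous fun u : NonzeroLipschitzFamily ρ => u.1.1 i (g * p.1) :=
    (continuous_apply (g * p.1)).comp ((continuous_apply i).comp
      (continuous_subtype_val.comp continuous_subtype_val))
  have h1 : ∀ᶠ q : G × NonzeroLipschitzFamily ρ in 𝓝 p,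
      dist (q.2.1.1 i (g * p.1)) (p.2.1.1 i (g * p.1)) < ε / 2 :=
    Metric.tendsto_nhds.1 ((hev.comp continuous_snd).continuousAt (x := p)) (ε / 2) (half_pos hε)
  have h2 : ∀ᶠ q : G × NonzeroLipschitzFamily ρ in 𝓝 p,
      ρ i (g * q.1 * (g * p.1)⁻¹) < ε / 2 :=
    (((continuous_const_mul g).comp continuous_fst).continuousAt (x := p)).eventually
      (eventually_length_mul_inv_lt (hρ i) (g * p.1) (half_pos hε))
  filter_upwards [h1, h2] with q hq1 hq2
  have h3 := (q.2.1.2 i (g * p.1)).2 (g * q.1 * (g * p.1)⁻¹)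
  rw [inv_mul_cancel_right] at h3
  calc dist (q.2.1.1 i (g * q.1)) (p.2.1.1 i (g * p.1))
      ≤ dist (q.2.1.1 i (g * q.1)) (q.2.1.1 i (g * p.1)) +
        dist (q.2.1.1 i (g * p.1)) (p.2.1.1 i (g * p.1)) := dist_triangle _ _ _
    _ < ε := by
        have h4 : dist (q.2.1.1 i (g * q.1)) (q.2.1.1 i (g * p.1)) < ε / 2 := h3.trans_lt hq2
        linarith

end LipschitzModel

/-! ### McShane extension from a dense sequence -/

section McShane

variable {G : Type*} [Group G] [TopologicalSpace G]

/-- The largest Lipschitz function below given values on a sequence. -/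
noncomputable def lipschitzExtension {G : Type*} [Group G] (ρ : G → ℝ) (D : ℕ → G)
    (a : ℕ → ℝ) (g : G) : ℝ :=
  ⨆ n, (a n - ρ (g * (D n)⁻¹))

theorem exists_length_mul_inv_lt [IsTopologicalGroup G] {ρ : G → ℝ}
    (hρ : IsContinuousLength ρ) {D : ℕ → G}
    (hD : DenseRange D) (g : G) {ε : ℝ} (hε : 0 < ε) : ∃ n, ρ (g * (D n)⁻¹) < ε := by
  obtain ⟨n, hn⟩ := hD.exists_mem_open isOpen_interior
    ⟨g, mem_interior_iff_mem_nhds.2 (eventually_length_mul_inv_lt hρ g hε)⟩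
  replace hn : D n ∈ {h | ρ (h * g⁻¹) < ε} := interior_subset hn
  rw [mem_ofPred_eq] at hn
  refine ⟨n, ?_⟩
  rwa [← hρ.map_inv, mul_inv_rev, inv_inv]

variable {ρ : G → ℝ} {D : ℕ → G} {a : ℕ → ℝ}

theorem bddAbove_lipschitzExtension (hρ : IsContinuousLength ρ)
    (ha : ∀ n, a n ≤ 1) (g : G) :
    BddAbove (range fun n => a n - ρ (g * (D n)⁻¹)) := by
  refine ⟨1, ?_⟩
  rintro _ ⟨n, rfl⟩
  linarith [ha n, hρ.nonneg (g * (D n)⁻¹)]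

theorem lipschitzExtension_mem_Icc (hρ : IsContinuousLength ρ)
    [IsTopologicalGroup G] (hD : DenseRange D) (ha : ∀ n, a n ∈ Icc (-1 : ℝ) 1) (g : G) :
    lipschitzExtension ρ D a g ∈ Icc (-1 : ℝ) 1 := by
  constructor
  · refine le_of_forall_pos_le_add fun ε hε => ?_
    obtain ⟨n, hn⟩ := exists_length_mul_inv_lt hρ hD g hε
    have := le_ciSup (bddAbove_lipschitzExtension (D := D) hρ (fun n => (ha n).2) g) n
    rw [lipschitzExtension]
    linarith [(ha n).1]
  · exact ciSup_le fun n => by linarith [(ha n).2, hρ.nonneg (g * (D n)⁻¹)]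

/-- Each term of the supremum changes by at most `ρ h`. The values `a` need not be compatible with
one another, so the bound holds for every `x` once `a` is read off an orbit. -/
theorem abs_lipschitzExtension_sub_le (hρ : IsContinuousLength ρ)
    (ha : ∀ n, a n ≤ 1) (h g : G) :
    |lipschitzExtension ρ D a (h * g) - lipschitzExtension ρ D a g| ≤ ρ h := by
  rw [abs_sub_le_iff]
  constructor
  · rw [sub_le_iff_le_add]
    refine ciSup_le fun n => ?_
    have h1 := le_ciSup (bddAbove_lipschitzExtension (D := D) hρ ha g) n
    have h2 := hρ.map_mul_le h⁻¹ (h * g * (D n)⁻¹)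
    rw [mul_assoc, inv_mul_cancel_left, hρ.map_inv, ← mul_assoc] at h2
    rw [lipschitzExtension]
    linarith
  · rw [sub_le_iff_le_add]
    refine ciSup_le fun n => ?_
    have h1 := le_ciSup (bddAbove_lipschitzExtension (D := D) hρ ha (h * g)) n
    have h2 := hρ.map_mul_le h (g * (D n)⁻¹)
    rw [← mul_assoc] at h2
    rw [lipschitzExtension]
    linarith

theorem lipschitzExtension_eq (hρ : IsContinuousLength ρ)
    [IsTopologicalGroup G] (hD : DenseRange D) (ha : ∀ n, a n ≤ 1) {g : G} {b : ℝ}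
    (hb : ∀ n, |b - a n| ≤ ρ (g * (D n)⁻¹)) : lipschitzExtension ρ D a g = b := by
  refine le_antisymm (ciSup_le fun n => ?_) (le_of_forall_pos_le_add fun ε hε => ?_)
  · linarith [(abs_le.1 (hb n)).1]
  · obtain ⟨n, hn⟩ := exists_length_mul_inv_lt hρ hD g (half_pos hε)
    have := le_ciSup (bddAbove_lipschitzExtension (D := D) hρ ha g) n
    rw [lipschitzExtension]
    linarith [(abs_le.1 (hb n)).2]

end McShane

/-! ### Transport of the model to the original space -/

section Transport

/-- Viewed as a plane, `T` splits into uncountably many disjoint uncountable lines, and an s-finite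
measure charges only countably many of them. -/
theorem exists_uncountable_null_subset {X : Type*} [MeasurableSpace X] [StandardBorelSpace X]
    (lam : Measure X) [SFinite lam] {T : Set X} (hT : MeasurableSet T) (hTc : ¬ T.Countable) :
    ∃ N ⊆ T, MeasurableSet N ∧ lam N = 0 ∧ ¬ N.Countable := by
  have hR : ¬ Countable (ℝ × ℝ) := by
    rw [not_countable_iff]
    infer_instance
  have : StandardBorelSpace T := hT.standardBorel
  let e : T ≃ᵐ ℝ × ℝ := PolishSpace.measurableEquivOfNotCountable hTc hR
  let A : ℝ → Set X := fun t => Subtype.val '' ((fun x => (e x).1) ⁻¹' {t})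
  have hA : ∀ t, MeasurableSet (A t) := fun t =>
    hT.subtype_image ((measurable_fst.comp e.measurable) (measurableSet_singleton t))
  have hd : Pairwise (Function.onFun Disjoint A) := fun s t hst => by
    refine (disjoint_image_iff Subtype.val_injective).2 (disjoint_left.2 fun x hx hy => hst ?_)
    rw [← mem_singleton_iff.1 hx, ← mem_singleton_iff.1 hy]
  have hc := Measure.countable_meas_pos_of_disjoint_iUnion (μ := lam) hA hd
  obtain ⟨t, ht⟩ : ∃ t, t ∉ {i | 0 < lam (A i)} := by
    by_contra! h
    exact Set.not_countable_univ (hc.mono fun t _ => h t)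
  refine ⟨A t, Subtype.coe_image_subset _ _, hA t, by simpa using ht, fun hcount => ?_⟩
  have himg : (fun x => (e x).2) '' ((fun x => (e x).1) ⁻¹' {t}) = univ :=
    eq_univ_of_forall fun r => ⟨e.symm (t, r), by simp, by simp⟩
  have hcount2 := (countable_of_injective_of_countable_image Subtype.val_injective.injOn
    hcount).image fun x => (e x).2
  rw [himg] at hcount2
  exact Set.not_countable_univ hcount2

/-- A Borel map from an atomless standard space which is injective on a conull set agrees almost
everywhere with a Borel isomorphism. -/
theorem exists_measurableEquiv_ae_eq {X Y : Type*} [MeasurableSpace X] [StandardBorelSpace X]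
    [MeasurableSpace Y] [StandardBorelSpace Y] {lam : Measure X} [SigmaFinite lam]
    [NullSingletonClass lam] (hlam : lam ≠ 0) {Φ : X → Y} (hΦ : Measurable Φ) {S : Set X}
    (hS : ∀ᵐ x ∂lam, x ∈ S) (hinj : InjOn Φ S) : ∃ Ψ : X ≃ᵐ Y, ∀ᵐ x ∂lam, Ψ x = Φ x := by
  classical
  obtain ⟨T, hTS, hTm, hT⟩ : ∃ T ⊆ S, MeasurableSet T ∧ lam Tᶜ = 0 := by
    obtain ⟨V, hV, hVm, hV0⟩ := exists_measurable_superset_of_null (mem_ae_iff.1 hS)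
    exact ⟨Vᶜ, compl_subset_comm.1 hV, hVm.compl, by rwa [compl_compl]⟩
  have hTunc : ¬ T.Countable := by
    intro hc
    refine hlam (Measure.measure_univ_eq_zero.1 ?_)
    rw [← union_compl_self T]
    exact measure_union_null (hc.measure_zero lam) hT
  obtain ⟨N, hNT, hNm, hN0, hNc⟩ := exists_uncountable_null_subset lam hTm hTunc
  -- Discarding the null set `N` leaves uncountable complements of `R` and of its image, which are
  -- then Borel isomorphic.
  let R : Set X := T \ N
  have hRm : MeasurableSet R := hTm.diff hNm
  have hRinj : InjOn Φ R := hinj.mono (sdiff_subset.trans hTS)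
  have : StandardBorelSpace R := hRm.standardBorel
  have hΦR : MeasurableEmbedding fun x : R => Φ x :=
    (hΦ.comp measurable_subtype_coe).measurableEmbedding fun x y h =>
      Subtype.ext (hRinj x.2 y.2 h)
  have hVm : MeasurableSet (range fun x : R => Φ x) := hΦR.measurableSet_range
  have hRc : ¬ Countable (Rᶜ : Set X) := fun h =>
    hNc ((Set.countable_coe_iff.1 h).mono (show N ⊆ Rᶜ from fun x hx hxR => hxR.2 hx))
  have hVc : ¬ Countable ((range fun x : R => Φ x)ᶜ : Set Y) := by
    intro h
    have hsub : Φ '' N ⊆ (range fun x : R => Φ x)ᶜ := by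
      rintro _ ⟨x, hx, rfl⟩ ⟨y, hxy⟩
      exact y.2.2 (hinj (hTS y.2.1) (hTS (hNT hx)) hxy ▸ hx)
    exact hNc (countable_of_injective_of_countable_image (hinj.mono (hNT.trans hTS))
      ((Set.countable_coe_iff.1 h).mono hsub))
  have : StandardBorelSpace (Rᶜ : Set X) := hRm.compl.standardBorel
  have : StandardBorelSpace ((range fun x : R => Φ x)ᶜ : Set Y) := hVm.compl.standardBorel
  let e₂ : (Rᶜ : Set X) ≃ᵐ ((range fun x : R => Φ x)ᶜ : Set Y) :=
    PolishSpace.measurableEquivOfNotCountable hRc hVc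
  refine ⟨((MeasurableEquiv.sumCompl hRm).symm.trans
    (MeasurableEquiv.sumCongr hΦR.equivRange e₂)).trans (MeasurableEquiv.sumCompl hVm), ?_⟩
  have hR0 : ∀ᵐ x ∂lam, x ∈ R := by
    rw [ae_iff]
    refine measure_mono_null ?_ (measure_union_null hT hN0)
    intro x hx
    by_contra h
    rw [mem_union, not_or, notMem_compl_iff] at h
    exact hx h
  filter_upwards [hR0] with x hx
  have h1 : (MeasurableEquiv.sumCompl hRm).symm x = Sum.inl ⟨x, hx⟩ := by
    rw [MeasurableEquiv.symm_apply_eq]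
    rfl
  simp only [MeasurableEquiv.trans_apply, h1]
  change (hΦR.equivRange ⟨x, hx⟩ : Y) = Φ x
  rw [MeasurableEmbedding.equivRange_apply]

/-- A continuous model that is almost everywhere equivariantly embedded can be transported to
the original space. -/
theorem liftsToContinuousRadonAction_of_model {G X Y : Type*} [Group G] [TopologicalSpace G]
    [MeasurableSpace G] [MeasurableSpace X] [StandardBorelSpace X] {lam : Measure X}
    [SigmaFinite lam] [NullSingletonClass lam] (hlam : lam ≠ 0) {α : G × X → X}
    (hα : IsBooleanAction α lam) [TopologicalSpace Y] [LocallyCompactSpace Y] [PolishSpace Y]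
    [MeasurableSpace Y] [BorelSpace Y] {β : G × Y → Y} (hβ1 : ∀ y, β (1, y) = y)
    (hβm : ∀ g h y, β (g * h, y) = β (g, β (h, y))) (hβc : Continuous β) {Φ : X → Y}
    (hΦ : Measurable Φ) {S : Set X} (hS : ∀ᵐ x ∂lam, x ∈ S) (hinj : InjOn Φ S)
    (hloc : IsLocallyFiniteMeasure (lam.map Φ))
    (heq : ∀ g, ∀ᵐ x ∂lam, Φ (α (g, x)) = β (g, Φ x)) :
    LiftsToContinuousRadonAction α lam := by
  obtain ⟨Ψ, hΨ⟩ := exists_measurableEquiv_ae_eq hlam hΦ hS hinj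
  have hmap : lam.map Ψ = lam.map Φ := Measure.map_congr hΨ
  have hΨeq : ∀ g, ∀ᵐ x ∂lam, β (g, Ψ x) = Ψ (α (g, x)) := by
    intro g
    filter_upwards [heq g, hΨ, (hα.measurePreserving g).quasiMeasurePreserving.ae hΨ]
      with x h1 h2 h3
    rw [h2, h3, h1]
  let : TopologicalSpace X := TopologicalSpace.induced Ψ inferInstance
  let Θ : X ≃ₜ Y := Ψ.toEquiv.toHomeomorphOfIsInducing ⟨rfl⟩
  have hΘ : ∀ x, Θ x = Ψ x := fun _ => rfl
  have hpol : PolishSpace X := Θ.isClosedEmbedding.polishSpace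
  have hlc : LocallyCompactSpace X := Θ.isClosedEmbedding.locallyCompactSpace
  have hbor : BorelSpace X := by
    refine ⟨?_⟩
    rw [borel_comap (f := Ψ) (t := inferInstance), ← BorelSpace.measurable_eq (α := Y)]
    exact Ψ.measurableEmbedding.comap_eq.symm
  have hreg : lam.Regular := by
    have hfin : IsLocallyFiniteMeasure lam := by
      refine ⟨fun x => ?_⟩
      obtain ⟨V, hV, hVfin⟩ := (lam.map Φ).finiteAt_nhds (Ψ x)
      refine ⟨Ψ ⁻¹' V, Θ.continuous.continuousAt hV, ?_⟩
      rwa [← hmap, Ψ.map_apply] at hVfin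
    infer_instance
  refine ⟨inferInstance, fun p => Ψ.symm (β (p.1, Ψ p.2)), hlc, hpol, hbor, hreg,
    ⟨fun x => ?_, fun g h x => ?_, ?_, fun g => ?_⟩, fun g => ?_⟩
  · simp [hβ1]
  · simp [hβm]
  · exact Θ.symm.continuous.comp
      (hβc.comp (continuous_fst.prodMk (Θ.continuous.comp continuous_snd)))
  · refine (hα.measurePreserving g).congr ?_ ?_
    · exact Ψ.symm.measurable.comp
        ((hβc.comp (Continuous.prodMk_right g)).measurable.comp Ψ.measurable)
    · filter_upwards [hΨeq g] with x hx
      simp only [hx, MeasurableEquiv.symm_apply_apply]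
  · filter_upwards [hΨeq g] with x hx
    simp only [hx, MeasurableEquiv.symm_apply_apply]

end Transport

/-! ### The orbit map into Lipschitz families -/

section Model

variable {G X ι : Type*} [Group G]

/-- The family of functions `g ↦ f i (α (g, x))`, corrected to be Lipschitz everywhere. -/
noncomputable def orbitFamily (α : G × X → X) (ρ : ι → G → ℝ) (D : ℕ → G) (f : ι → X → ℝ) (x : X)
    (i : ι) (g : G) : ℝ :=
  lipschitzExtension (ρ i) D (fun n => f i (α (D n, x))) g

theorem orbitFamily_mem [TopologicalSpace G] [IsTopologicalGroup G] {α : G × X → X}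
    {ρ : ι → G → ℝ} (hρ : ∀ i, IsContinuousLength (ρ i)) {D : ℕ → G}
    (hD : DenseRange D) {f : ι → X → ℝ} (hf : ∀ i x, f i x ∈ Icc (-1 : ℝ) 1) (x : X) :
    orbitFamily α ρ D f x ∈ lipschitzFamilies ρ := fun i g =>
  ⟨lipschitzExtension_mem_Icc (hρ i) hD (fun _ => hf i _) g, fun h =>
    abs_lipschitzExtension_sub_le (hρ i) (fun _ => (hf i _).2) h g⟩

variable [MeasurableSpace G] [MeasurableSpace X] {α : G × X → X} {lam : Measure X}

theorem measurable_orbitFamily (hα : IsBooleanAction α lam) {ρ : ι → G → ℝ} {D : ℕ → G}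
    {f : ι → X → ℝ} (hf : ∀ i, Measurable (f i)) (i : ι) (g : G) :
    Measurable fun x => orbitFamily α ρ D f x i g :=
  Measurable.iSup fun n => (((hf i).comp (hα.measurePreserving (D n)).measurable).sub_const _)

variable [TopologicalSpace G] [IsTopologicalGroup G]

/-- For a fixed `g`, only the countably many comparisons of `g` with the `D n` are needed, so the
exceptional set is null. -/
theorem orbitFamily_ae_eq (hα : IsBooleanAction α lam) {ρ : ι → G → ℝ}
    (hρ : ∀ i, IsContinuousLength (ρ i)) {D : ℕ → G} (hD : DenseRange D) {f : ι → X → ℝ}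
    (hf : ∀ i x, f i x ∈ Icc (-1 : ℝ) 1)
    (hLip : ∀ i h, ∀ᵐ x ∂lam, |f i (α (h, x)) - f i x| ≤ ρ i h) (i : ι) (g : G) :
    ∀ᵐ x ∂lam, orbitFamily α ρ D f x i g = f i (α (g, x)) := by
  have h1 : ∀ᵐ x ∂lam, ∀ n, |f i (α (g, x)) - f i (α (D n, x))| ≤ ρ i (g * (D n)⁻¹) := by
    refine ae_all_iff.2 fun n => ?_
    filter_upwards [hα.mul_ae (g * (D n)⁻¹) (D n),
      (hα.measurePreserving (D n)).quasiMeasurePreserving.ae (hLip i (g * (D n)⁻¹))]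
      with x hx1 hx2
    rw [inv_mul_cancel_right] at hx1
    rwa [hx1]
  filter_upwards [h1] with x hx
  exact lipschitzExtension_eq (hρ i) hD (fun _ => (hf i _).2) hx

/-- A Borel action with a point-separating countable family of functions along which the group acts
in a uniformly Lipschitz way lifts to a continuous Radon action. -/
theorem liftsToContinuousRadonAction_of_lipschitz_family [Countable ι]
    [TopologicalSpace.SeparableSpace G] [StandardBorelSpace X] [SigmaFinite lam]
    [NullSingletonClass lam] (hlam : lam ≠ 0) (hα : IsBooleanAction α lam) {ρ : ι → G → ℝ}
    (hρ : ∀ i, IsContinuousLength (ρ i)) {f : ι → X → ℝ} (hfm : ∀ i, Measurable (f i))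
    (hf : ∀ i x, f i x ∈ Icc (-1 : ℝ) 1) (hfin : ∀ i c, 0 < c → lam {x | c < |f i x|} < ⊤)
    (hLip : ∀ i h, ∀ᵐ x ∂lam, |f i (α (h, x)) - f i x| ≤ ρ i h) {S : Set X}
    (hS : ∀ᵐ x ∂lam, x ∈ S) (hsep : ∀ x ∈ S, ∀ y ∈ S, (∀ i, f i x = f i y) → x = y)
    (hne : ∀ x ∈ S, ∃ i, f i x ≠ 0) : LiftsToContinuousRadonAction α lam := by
  classical
  let D := TopologicalSpace.denseSeq G
  have : Nonempty G := ⟨1⟩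
  have hD : DenseRange D := TopologicalSpace.denseRange_denseSeq G
  have hpol := polishSpace_lipschitzFamilies hρ
  have hpol' := polishSpace_nonzeroLipschitzFamily hρ
  let u : X → lipschitzFamilies ρ := fun x => ⟨orbitFamily α ρ D f x, orbitFamily_mem hρ hD hf x⟩
  let S' : Set X := {x | x ∈ S ∧ ∀ i, orbitFamily α ρ D f x i 1 = f i x}
  have hS' : ∀ᵐ x ∂lam, x ∈ S' := by
    have h1 : ∀ᵐ x ∂lam, ∀ i, orbitFamily α ρ D f x i 1 = f i (α (1, x)) :=
      ae_all_iff.2 fun i => orbitFamily_ae_eq hα hρ hD hf hLip i 1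
    filter_upwards [hS, h1, hα.one_ae] with x hx1 hx2 hx3
    refine ⟨hx1, fun i => ?_⟩
    rw [hx2 i, hx3]
  have hu0 : ∀ x ∈ S', (u x : ι → G → ℝ) ≠ 0 := by
    intro x hx h0
    obtain ⟨i, hi⟩ := hne x hx.1
    rw [← hx.2 i] at hi
    exact hi (congrFun (congrFun h0 i) 1)
  obtain ⟨x₀, hx₀⟩ : ∃ x, x ∈ S' := by
    have : (ae lam).NeBot := ae_neBot.2 hlam
    exact hS'.exists
  let borelΩ : MeasurableSpace (lipschitzFamilies ρ) := borel _
  have hborelΩ : BorelSpace (lipschitzFamilies ρ) := ⟨rfl⟩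
  have hum : Measurable u := by
    rw [← (isClosedEmbedding_restrict_denseRange hρ hD).measurableEmbedding.measurable_comp_iff]
    exact measurable_pi_lambda _ fun i => measurable_pi_lambda _ fun n =>
      measurable_orbitFamily hα hfm i (D n)
  -- Points whose family vanishes form a null set and are sent to an arbitrary nonzero family.
  have hex : ∀ x, ∃ y : NonzeroLipschitzFamily ρ,
      y.1 = if (u x : ι → G → ℝ) ≠ 0 then u x else u x₀ := by
    intro x
    by_cases h : (u x : ι → G → ℝ) ≠ 0
    · exact ⟨⟨u x, h⟩, (if_pos h).symm⟩
    · exact ⟨⟨u x₀, hu0 x₀ hx₀⟩, (if_neg h).symm⟩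
  choose Φ hΦ using hex
  have hΦu : ∀ x ∈ S', (Φ x).1 = u x := fun x hx => (hΦ x).trans (if_pos (hu0 x hx))
  have hemb : MeasurableEmbedding (fun y : NonzeroLipschitzFamily ρ => y.1) :=
    have h : IsOpenEmbedding (fun y : NonzeroLipschitzFamily ρ => y.1) :=
      (isOpen_nonzero_lipschitzFamilies ρ).isOpenEmbedding_subtypeVal
    h.measurableEmbedding
  have hΦm : Measurable Φ := by
    rw [← hemb.measurable_comp_iff]
    have hmeas : MeasurableSet {x | (u x : ι → G → ℝ) ≠ 0} :=
      hum (isOpen_nonzero_lipschitzFamilies ρ).measurableSet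
    rw [show (fun y : NonzeroLipschitzFamily ρ => y.1) ∘ Φ = _ from funext hΦ]
    exact Measurable.ite hmeas hum measurable_const
  have hinj : InjOn Φ S' := by
    intro x hx y hy hxy
    refine hsep x hx.1 y hy.1 fun i => ?_
    have h1 : u x = u y := by rw [← hΦu x hx, ← hΦu y hy, hxy]
    rw [← hx.2 i, ← hy.2 i]
    exact congrFun (congrFun (congrArg Subtype.val h1) i) 1
  refine liftsToContinuousRadonAction_of_model hlam hα (β := rightTranslate ρ) (fun y => ?_)
    (fun g h y => ?_) (continuous_rightTranslate hρ) hΦm hS' hinj ⟨fun y => ?_⟩ fun k => ?_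
  · refine Subtype.ext (Subtype.ext ?_)
    funext i g
    simp [rightTranslate]
  · refine Subtype.ext (Subtype.ext ?_)
    funext i k
    simp [rightTranslate, mul_assoc]
  -- Local finiteness: near `y` one coordinate stays away from zero, and almost all of the preimage
  -- lies in a translate of a superlevel set of `f i`, of finite measure. This fails in general at
  -- the zero family.
  · obtain ⟨i, g, hig⟩ : ∃ i g, y.1.1 i g ≠ 0 := by
      by_contra! h
      exact y.2 (funext fun i => funext fun g => h i g)
    have hpos : 0 < |y.1.1 i g| / 2 := half_pos (abs_pos.2 hig)
    have hev : Continuous fun w : NonzeroLipschitzFamily ρ => |w.1.1 i g| :=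
      ((continuous_apply g).comp ((continuous_apply i).comp
        (continuous_subtype_val.comp continuous_subtype_val))).abs
    have hopen : IsOpen {w : NonzeroLipschitzFamily ρ | |y.1.1 i g| / 2 < |w.1.1 i g|} :=
      isOpen_lt continuous_const hev
    refine ⟨_, hopen.mem_nhds (half_lt_self (abs_pos.2 hig)), ?_⟩
    rw [Measure.map_apply hΦm hopen.measurableSet]
    refine lt_of_le_of_lt (measure_mono_ae
      (t := (fun x => α (g, x)) ⁻¹' {x | |y.1.1 i g| / 2 < |f i x|}) ?_) ?_
    · filter_upwards [hS', orbitFamily_ae_eq hα hρ hD hf hLip i g] with x hx1 hx2 hx3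
      change |y.1.1 i g| / 2 < |(Φ x).1.1 i g| at hx3
      rw [hΦu x hx1] at hx3
      change |y.1.1 i g| / 2 < |orbitFamily α ρ D f x i g| at hx3
      rwa [hx2] at hx3
    · rw [(hα.measurePreserving g).measure_preimage
        (measurableSet_lt measurable_const (hfm i).abs).nullMeasurableSet]
      exact hfin i _ hpos
  -- Lipschitz families are determined by their values on the dense sequence, so countably many
  -- almost everywhere identities suffice.
  · have h1 : ∀ᵐ x ∂lam, ∀ i n, orbitFamily α ρ D f (α (k, x)) i (D n) =
        orbitFamily α ρ D f x i (D n * k) := by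
      refine ae_all_iff.2 fun i => ae_all_iff.2 fun n => ?_
      filter_upwards [(hα.measurePreserving k).quasiMeasurePreserving.ae
        (orbitFamily_ae_eq hα hρ hD hf hLip i (D n)),
        orbitFamily_ae_eq hα hρ hD hf hLip i (D n * k), hα.mul_ae (D n) k] with x hx1 hx2 hx3
      rw [hx1, hx2, hx3]
    filter_upwards [h1, hS', (hα.measurePreserving k).quasiMeasurePreserving.ae hS']
      with x hx1 hx2 hx3
    refine Subtype.ext (Subtype.ext ?_)
    refine eq_of_forall_eq_denseRange hρ hD (Φ (α (k, x))).1.2 (rightTranslate ρ (k, Φ x)).1.2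
      fun i n => ?_
    change (Φ (α (k, x))).1.1 i (D n) = (Φ x).1.1 i (D n * k)
    rw [hΦu _ hx3, hΦu _ hx2]
    exact hx1 i n

end Model

/-! ### Separating functions and conclusion -/

/-- In a standard Borel space with a σ-finite measure, countably many sets of finite measure cover
the space and separate its points. -/
theorem exists_countable_separating_finite_measure {X : Type*} [MeasurableSpace X]
    [StandardBorelSpace X] (lam : Measure X) [SigmaFinite lam] :
    ∃ A : ℚ × ℕ → Set X, (∀ j, MeasurableSet (A j)) ∧ (∀ j, lam (A j) < ⊤) ∧
      (∀ x, ∃ j, x ∈ A j) ∧ ∀ x y, (∀ j, x ∈ A j ↔ y ∈ A j) → x = y := by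
  have hm : Measurable (embeddingReal X) := (measurableEmbedding_embeddingReal X).measurable
  have hmem : ∀ x, ∃ k, x ∈ spanningSets lam k := fun x =>
    mem_iUnion.1 ((iUnion_spanningSets lam).symm ▸ mem_univ x)
  have hsep : ∀ x y, embeddingReal X x < embeddingReal X y →
      ∃ j : ℚ × ℕ, x ∈ {x | embeddingReal X x < j.1} ∩ spanningSets lam j.2 ∧
        y ∉ {x | embeddingReal X x < j.1} ∩ spanningSets lam j.2 := by
    intro x y hxy
    obtain ⟨q, hq1, hq2⟩ := exists_rat_btwn hxy
    obtain ⟨k, hk⟩ := hmem x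
    exact ⟨(q, k), ⟨hq1, hk⟩, fun h => (lt_asymm hq2 h.1)⟩
  refine ⟨fun j => {x | embeddingReal X x < j.1} ∩ spanningSets lam j.2, fun j => ?_, fun j => ?_,
    fun x => ?_, fun x y hxy => ?_⟩
  · exact (measurableSet_lt hm measurable_const).inter (measurableSet_spanningSets lam j.2)
  · exact (measure_mono inter_subset_right).trans_lt (measure_spanningSets_lt_top lam j.2)
  · obtain ⟨q, hq⟩ := exists_rat_gt (embeddingReal X x)
    obtain ⟨k, hk⟩ := hmem x
    exact ⟨(q, k), hq, hk⟩
  · refine (measurableEmbedding_embeddingReal X).injective ?_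
    by_contra hne
    rcases lt_or_gt_of_ne hne with h | h
    · obtain ⟨j, h1, h2⟩ := hsep x y h
      exact h2 ((hxy j).1 h1)
    · obtain ⟨j, h1, h2⟩ := hsep y x h
      exact h2 ((hxy j).2 h1)

/-- Lipschitz approximants of countably many separating indicators still separate points: along a
subsequence they converge almost everywhere to the indicators. -/
theorem liftsToContinuousRadonAction_isometryGroup {M : Type*} [MetricSpace M]
    [LocallyCompactSpace M] [TopologicalSpace.SeparableSpace M] {X : Type*} [MeasurableSpace X]
    [StandardBorelSpace X] {lam : Measure X} [SigmaFinite lam] [NullSingletonClass lam]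
    (hlam : lam ≠ 0) {α : (M ≃ᵢ M) × X → X} (hα : IsBooleanAction α lam) :
    LiftsToContinuousRadonAction α lam := by
  obtain ⟨A, hAm, hAfin, hAcov, hAsep⟩ := exists_countable_separating_finite_measure lam
  let F : ℚ × ℕ → Lp ℝ 2 lam := fun j => indicatorConstLp 2 (hAm j) (hAfin j).ne 1
  have hF : ∀ j, F j =ᵐ[lam] (A j).indicator fun _ => (1 : ℝ) := fun j => indicatorConstLp_coeFn
  have hF1 : ∀ j, ∀ᵐ x ∂lam, |F j x| ≤ 1 := by
    intro j
    filter_upwards [hF j] with x hx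
    rw [hx]
    by_cases h : x ∈ A j <;> simp [h]
  choose v ρ hρ hv hv1 hvL using fun (j : ℚ × ℕ) (n : ℕ) =>
    exists_lipschitz_approximation hα (hF1 j) (Nat.one_div_pos_of_nat (α := ℝ) (n := n))
  have hlim : ∀ j, Tendsto (v j) atTop (𝓝 (F j)) := by
    intro j
    rw [tendsto_iff_norm_sub_tendsto_zero]
    exact squeeze_zero (fun _ => norm_nonneg _) (hv j) tendsto_one_div_add_atTop_nhds_zero_nat
  choose ns _ hns using fun j => (tendstoInMeasure_of_tendsto_Lp (hlim j)).exists_seq_tendsto_ae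
  -- Truncation changes the approximants only on null sets and makes the bound by `1` hold
  -- everywhere.
  let f : (ℚ × ℕ) × ℕ → X → ℝ := fun i x => max (-1) (min 1 (v i.1 i.2 x))
  have hfv : ∀ i, ∀ᵐ x ∂lam, f i x = v i.1 i.2 x := by
    intro i
    filter_upwards [hv1 i.1 i.2] with x hx
    obtain ⟨h1, h2⟩ := abs_le.1 hx
    simp only [f, min_eq_right h2, max_eq_right h1]
  have hfm : ∀ i, Measurable (f i) := fun i =>
    measurable_const.max (measurable_const.min (Lp.stronglyMeasurable _).measurable)
  let S : Set X := {x | (∀ i, f i x = v i.1 i.2 x) ∧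
    ∀ j, Tendsto (fun n => v j (ns j n) x) atTop (𝓝 ((A j).indicator (fun _ => (1 : ℝ)) x))}
  have hS : ∀ᵐ x ∂lam, x ∈ S := by
    filter_upwards [ae_all_iff.2 hfv, ae_all_iff.2 hns, ae_all_iff.2 hF] with x h1 h2 h3
    refine ⟨h1, fun j => ?_⟩
    rw [← h3 j]
    exact h2 j
  have hSlim : ∀ x ∈ S, ∀ j, Tendsto (fun n => f (j, ns j n) x) atTop
      (𝓝 ((A j).indicator (fun _ => (1 : ℝ)) x)) := fun x hx j =>
    (hx.2 j).congr fun n => (hx.1 (j, ns j n)).symm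
  refine liftsToContinuousRadonAction_of_lipschitz_family hlam hα (ρ := fun i => ρ i.1 i.2)
    (fun i => hρ i.1 i.2) hfm (fun i x => ⟨le_max_left _ _, max_le (by norm_num) (min_le_left _ _)⟩)
    (fun i c hc => ?_) (fun i h => ?_) hS (fun x hx y hy hxy => hAsep x y fun j => ?_)
    (fun x hx => ?_)
  · have h1 := (Lp.memLp (v i.1 i.2)).meas_ge_lt_top two_ne_zero ENNReal.ofNat_ne_top
      (ε := ⟨c, hc.le⟩) (fun h => hc.ne' (congrArg NNReal.toReal h))
    refine lt_of_le_of_lt (measure_mono_ae ?_) h1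
    filter_upwards [hfv i] with x hx hcx
    replace hcx : c < |f i x| := hcx
    rw [hx] at hcx
    exact hcx.le
  · filter_upwards [hvL i.1 i.2 h, hfv i,
      (hα.measurePreserving h).quasiMeasurePreserving.ae (hfv i)] with x h1 h2 h3
    rwa [h2, h3]
  · have h1 : (A j).indicator (fun _ => (1 : ℝ)) x = (A j).indicator (fun _ => (1 : ℝ)) y :=
      tendsto_nhds_unique (hSlim x hx j) ((hSlim y hy j).congr fun n => (hxy _).symm)
    constructor <;> intro hm <;> by_contra hn <;>
      rw [indicator_of_mem hm, indicator_of_notMem hn] at h1 <;> norm_num at h1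
  · by_contra! h0
    obtain ⟨j, hj⟩ := hAcov x
    have h1 := hSlim x hx j
    rw [indicator_of_mem hj] at h1
    exact zero_ne_one (tendsto_nhds_unique (tendsto_const_nhds.congr fun n => (h0 _).symm) h1)

/-- A continuous Radon action on the space itself is a continuous Radon model. -/
theorem LiftsToContinuousRadonAction.admitsContinuousRadonModel {G : Type*} {X : Type u} [Group G]
    [TopologicalSpace G] [MeasurableSpace X] {α : G × X → X} {lam : Measure X}
    (h : LiftsToContinuousRadonAction α lam) : AdmitsContinuousRadonModel α lam := by
  obtain ⟨tX, β, hlc, hpol, hbor, hreg, hβ, hae⟩ := h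
  refine ⟨X, tX, inferInstance, lam, β, univ, Subtype.val, hlc, hpol, hbor, hreg, hβ,
    ⟨MeasurableSet.univ, ae_of_all _ mem_univ, Subtype.val_injective, ⟨measurable_subtype_coe, ?_⟩,
      fun g => ?_⟩⟩
  · rw [(MeasurableEmbedding.subtype_coe MeasurableSet.univ).map_comap, Subtype.range_coe,
      Measure.restrict_univ]
  · filter_upwards [hae g] with x hx
    exact ⟨mem_univ _, mem_univ _, hx.symm⟩

theorem theoremD {M : Type*} [MetricSpace M] [LocallyCompactSpace M]
    [TopologicalSpace.SeparableSpace M]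
    {X : Type u} [MeasurableSpace X] [StandardBorelSpace X] [Uncountable X]
    (lam : Measure X) [SigmaFinite lam] [NullSingletonClass lam] (hlam : lam ≠ 0)
    (α : (M ≃ᵢ M) × X → X) (hα : IsBooleanAction α lam) :
    AdmitsContinuousRadonModel α lam ∧ LiftsToContinuousRadonAction α lam :=
  have h := liftsToContinuousRadonAction_isometryGroup hlam hα
  ⟨h.admitsContinuousRadonModel, h⟩
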